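/- Let $n,k,q\ge 0$ be integers, and let $A\in\mathbb R^{n\times n}$ be a Schur matrix, i.e. $zI_n-A$ is nonsingular for every $z\in\mathbb C$ with $|z|\ge 1$. Let $B_1\in\mathbb R^{n\times k}$, $B_2\in\mathbb R^{n\times q}$, $B=[B_1,\,B_2]$, and let $Q$ be a real square matrix of size $n+k+q$. For $|z|\ge1$ put $$\Pi(z)=\begin{bmatrix}(zI_n-A)^{-1}B\\ I_{k+q}\end{bmatrix}^{*}Q\begin{bmatrix}(zI_n-A)^{-1}B\\ I_{k+q}\end{bmatrix}=\begin{bmatrix}\Pi_{11}(z)&\Pi_{12}(z)\\ \Pi_{21}(z)&\Pi_{22}(z)\end{bmatrix},$$ where $^*$ is the conjugate transpose, $\Pi_{11}(z)\in\mathbb C^{k\times k}$ and $\Pi_{22}(z)\in\mathbb C^{q\times q}$. Assume that there are $\varepsilon>0$ and $z_0\in\mathbb C$ with $|z_0|=1$ such that $$\begin{bmatrix}\Pi_{11}(z)&\varepsilon\Pi_{12}(z)\\ \varepsilon\Pi_{21}(z)&-\Pi_{22}(z)\end{bmatrix}\ge 0\quad\text{for all } z\in\mathbb C,\ |z|=1,\qquad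 \Pi_{11}(z_0)>0,\qquad \Pi_{22}(z_0)<0,$$ where $M\ge0$ ($M>0$, $M<0$) means that $M$ is Hermitian and positive semidefinite (positive definite, negative definite). Let $\ell^2_m$ be the real Hilbert space of square summable sequences $u:\{0,1,2,\dots\}\to\mathbb R^m$, with norm $\|u\|^2=\sum_{t\ge0}|u(t)|^2$. For $a\in\mathbb R^n$, $v\in\ell^2_k$, $w\in\ell^2_q$ let $$g(v,w)=\sum_{t=0}^\infty\sigma(x(t),v(t),w(t)),\qquad x(t+1)=Ax(t)+B_1v(t)+B_2w(t),\quad x(0)=a,$$ where $\sigma(x,v,w)=\begin{bmatrix}x\\v\\w\end{bmatrix}^{\top}Q\begin{bmatrix}x\\v\\w\end{bmatrix}$. Then for every $a\in\mathbb R^n$ the series defining $g(v,w)$ converges absolutely for all $(v,w)\in\ell^2_k\times\ell^2_q$, and: (a) for every $w\in\ell^2_q$ the value $\inf_{v\in\ell^2_k}g(v,w)$ is finite, for every $v\in\ell^2_k$ the value $\sup_{w\in\ell^2_q}g(v,w)$ is finite, and the functions $w\mapsto\inf_{v}g(v,w)$ and $v\mapsto\sup_{w}g(v,w)$ are continuous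 on $\ell^2_q$ and $\ell^2_k$, respectively, in the norm topologies; (b) the minimax identity $$\inf_{v\in\ell^2_k}\,\sup_{w\in\ell^2_q}g(v,w)=\sup_{w\in\ell^2_q}\,\inf_{v\in\ell^2_k}g(v,w)$$ holds, both sides being finite. -/

import Mathlib

open Matrix
open scoped ComplexOrder

namespace KYPMinimax

/-- A real square matrix is Schur if `z I - A` is nonsingular for all complex `z`, `|z| ≥ 1`. -/
def IsSchur {n : ℕ} (A : Matrix (Fin n) (Fin n) ℝ) : Prop :=
  ∀ z : ℂ, 1 ≤ ‖z‖ → (z • (1 : Matrix (Fin n) (Fin n) ℂ) - A.map Complex.ofReal).det ≠ 0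

/-- The real Hilbert space of square summable sequences of vectors in (Euclidean) `ℝ^m`. -/
abbrev Ell2 (m : ℕ) : Type := lp (fun _ : ℕ => EuclideanSpace ℝ (Fin m)) 2

/-- The state sequence: `x 0 = a`, `x (t+1) = A x(t) + B₁ v(t) + B₂ w(t)`. -/
def state {n k q : ℕ} (A : Matrix (Fin n) (Fin n) ℝ) (B₁ : Matrix (Fin n) (Fin k) ℝ)
    (B₂ : Matrix (Fin n) (Fin q) ℝ) (a : Fin n → ℝ) (v : Ell2 k) (w : Ell2 q) :
    ℕ → (Fin n → ℝ)
  | 0 => a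
  | t + 1 => A *ᵥ state A B₁ B₂ a v w t + B₁ *ᵥ (v t).ofLp + B₂ *ᵥ (w t).ofLp

/-- The quadratic form `σ(x,v,w) = [x; v; w]' Q [x; v; w]`. -/
def quadForm {n k q : ℕ}
    (Q : Matrix (Fin n ⊕ (Fin k ⊕ Fin q)) (Fin n ⊕ (Fin k ⊕ Fin q)) ℝ)
    (x : Fin n → ℝ) (v : Fin k → ℝ) (w : Fin q → ℝ) : ℝ :=
  Sum.elim x (Sum.elim v w) ⬝ᵥ Q *ᵥ Sum.elim x (Sum.elim v w)

/-- The term `σ(x(t), v(t), w(t))` of the cost along a trajectory. -/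
def stageCost {n k q : ℕ} (A : Matrix (Fin n) (Fin n) ℝ) (B₁ : Matrix (Fin n) (Fin k) ℝ)
    (B₂ : Matrix (Fin n) (Fin q) ℝ)
    (Q : Matrix (Fin n ⊕ (Fin k ⊕ Fin q)) (Fin n ⊕ (Fin k ⊕ Fin q)) ℝ)
    (a : Fin n → ℝ) (v : Ell2 k) (w : Ell2 q) (t : ℕ) : ℝ :=
  quadForm Q (state A B₁ B₂ a v w t) (v t).ofLp (w t).ofLp

/-- The functional `g(v,w) = ∑ₜ σ(x(t), v(t), w(t))`. -/
noncomputable def cost {n k q : ℕ} (A : Matrix (Fin n) (Fin n) ℝ)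
    (B₁ : Matrix (Fin n) (Fin k) ℝ) (B₂ : Matrix (Fin n) (Fin q) ℝ)
    (Q : Matrix (Fin n ⊕ (Fin k ⊕ Fin q)) (Fin n ⊕ (Fin k ⊕ Fin q)) ℝ)
    (a : Fin n → ℝ) (v : Ell2 k) (w : Ell2 q) : ℝ :=
  ∑' t : ℕ, stageCost A B₁ B₂ Q a v w t

/-- `[(zI - A)⁻¹ B; I]` with `B = [B₁, B₂]`. -/
noncomputable def transfer {n k q : ℕ} (A : Matrix (Fin n) (Fin n) ℝ)
    (B₁ : Matrix (Fin n) (Fin k) ℝ) (B₂ : Matrix (Fin n) (Fin q) ℝ) (z : ℂ) :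
    Matrix (Fin n ⊕ (Fin k ⊕ Fin q)) (Fin k ⊕ Fin q) ℂ :=
  Matrix.fromRows
    ((z • (1 : Matrix (Fin n) (Fin n) ℂ) - A.map Complex.ofReal)⁻¹ *
      (Matrix.fromCols B₁ B₂).map Complex.ofReal) 1

/-- `Π(z) = [(zI - A)⁻¹ B; I]' Q [(zI - A)⁻¹ B; I]` with `B = [B₁, B₂]`; its blocks
`Π₁₁, Π₁₂, Π₂₁, Π₂₂` are `toBlocks₁₁, …, toBlocks₂₂`. -/
noncomputable def popov {n k q : ℕ} (A : Matrix (Fin n) (Fin n) ℝ)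
    (B₁ : Matrix (Fin n) (Fin k) ℝ) (B₂ : Matrix (Fin n) (Fin q) ℝ)
    (Q : Matrix (Fin n ⊕ (Fin k ⊕ Fin q)) (Fin n ⊕ (Fin k ⊕ Fin q)) ℝ) (z : ℂ) :
    Matrix (Fin k ⊕ Fin q) (Fin k ⊕ Fin q) ℂ :=
  (transfer A B₁ B₂ z)ᴴ * Q.map Complex.ofReal * transfer A B₁ B₂ z

/-- The matrix `[[Π₁₁(z), ε Π₁₂(z)], [ε Π₂₁(z), -Π₂₂(z)]]`. -/
noncomputable def scaledPopov {n k q : ℕ} (A : Matrix (Fin n) (Fin n) ℝ)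
    (B₁ : Matrix (Fin n) (Fin k) ℝ) (B₂ : Matrix (Fin n) (Fin q) ℝ)
    (Q : Matrix (Fin n ⊕ (Fin k ⊕ Fin q)) (Fin n ⊕ (Fin k ⊕ Fin q)) ℝ) (ε : ℝ) (z : ℂ) :
    Matrix (Fin k ⊕ Fin q) (Fin k ⊕ Fin q) ℂ :=
  Matrix.fromBlocks
    (popov A B₁ B₂ Q z).toBlocks₁₁ ((ε : ℂ) • (popov A B₁ B₂ Q z).toBlocks₁₂)
    ((ε : ℂ) • (popov A B₁ B₂ Q z).toBlocks₂₁) (-(popov A B₁ B₂ Q z).toBlocks₂₂)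

end KYPMinimax

/-! Fix `a`. The cost is a quadratic functional F(v) + 2m(v,w) - G(w) + 2ℓ₁(v) + 2ℓ₂(w) + c, where
F, G and m come from zero initial state and ℓ₁, ℓ₂ pair the free response of `a` with the responses
to v and w. F and G are positive semidefinite, but the Popov blocks may be singular at points of the
circle, so neither form need be coercive on ℓ². What saves the minimax identity is that m, ℓ₁ and ℓ₂
are bounded in the seminorms of F and G, not merely in ℓ².

Given these bounds, `minimax_quadratic` completes the input spaces for F and G to Hilbert spaces H
and K. There m becomes a bounded operator N and ℓ₁, ℓ₂ become vectors. Completing squares gives the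
partial optima explicitly, and a saddle point exists because 1 + N*N is invertible. It need not come
from ℓ² inputs, but the images of the input spaces are dense, which is enough for infima, suprema
and continuity.

Bound on m: by Parseval (`IsSchur.integral_inputPopov`) the frequency condition integrates to F(v) +
2εm(v,w) + G(w) ≥ 0 (`IsSchur.scaled_cost_nonneg`). Scaling v and taking the discriminant gives m² ≤
ε⁻² F G.

Bound on ℓ₁ and ℓ₂ (`IsSchur.exists_free_sq_le`): definiteness at `z₀` makes the determinant of the
relevant Popov block a nonzero rational function. Hence the block is bounded below on the circle by
a multiple of |p|², with p a real polynomial from which all factors shared with the characteristic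
polynomial of A have been removed, so that p(A) is invertible
(`IsSchur.exists_polynomial_lower_bound`). Delaying the input by the shift S replaces a by Aa in the
pairing, so with a = p(A)a' the pairing of a with u is that of a' with p(S)u
(`IsSchur.outputForm_free_aeval`). The latter is bounded by the ℓ² norm of p(S)u, and by Parseval
the square of this norm is at most a constant times the integral of |p|²|û|², hence of the Popov
form. -/

namespace KYPMinimax

open scoped InnerProductSpace RealInnerProductSpace

/-! ### Completion of a semidefinite form, and representation of dominated functionals. -/

section HilbertRealization

/-- A positive semidefinite symmetric bilinear form is realized, up to its kernel, as the inner
product of a Hilbert space in which the original space has dense image. -/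
theorem exists_hilbert_realization.{u} {V : Type u} [AddCommGroup V] [Module ℝ V]
    (f : V →ₗ[ℝ] V →ₗ[ℝ] ℝ) (hs : ∀ x y, f x y = f y x) (hp : ∀ x, 0 ≤ f x x) :
    ∃ (H : Type u) (_ : NormedAddCommGroup H) (_ : InnerProductSpace ℝ H) (_ : CompleteSpace H)
      (i : V →ₗ[ℝ] H), DenseRange i ∧ ∀ x y, inner ℝ (i x) (i y) = f x y := by
  let core : PreInnerProductSpace.Core ℝ V :=
    { inner := fun x y => f x y
      conj_inner_symm := fun x y => by simpa using hs y x
      re_inner_nonneg := fun x => by simpa using hp x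
      add_left := fun x y z => by simp
      smul_left := fun x y r => by simp }
  let _ : SeminormedAddCommGroup V := @InnerProductSpace.Core.toSeminormedAddCommGroup ℝ V _ _ _ core
  let _ : InnerProductSpace ℝ V := InnerProductSpace.ofCore core
  refine ⟨UniformSpace.Completion V, inferInstance, inferInstance, inferInstance,
    (UniformSpace.Completion.toComplL (𝕜 := ℝ) (E := V)).toLinearMap,
    UniformSpace.Completion.denseRange_coe, fun x y => ?_⟩
  exact UniformSpace.Completion.inner_coe x y

/-- A functional dominated by the norm along a dense linear map is represented by a vector. -/
theorem exists_inner_eq_of_denseRange {V H : Type*} [AddCommGroup V] [Module ℝ V]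
    [NormedAddCommGroup H] [InnerProductSpace ℝ H] [CompleteSpace H] (i : V →ₗ[ℝ] H)
    (hi : DenseRange i) (f : V →ₗ[ℝ] ℝ) (C : ℝ) (hf : ∀ x, |f x| ≤ C * ‖i x‖) :
    ∃ b : H, ∀ x, f x = inner ℝ b (i x) := by
  refine ⟨(InnerProductSpace.toDual ℝ H).symm (f.extendOfNorm i), fun x => ?_⟩
  rw [InnerProductSpace.toDual_symm_apply, LinearMap.extendOfNorm_eq hi ⟨C, hf⟩]

/-- A bilinear form dominated by the norms along dense linear maps is represented by a bounded
operator. -/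
theorem exists_clm_inner_eq_of_denseRange {V W H K : Type*} [AddCommGroup V] [Module ℝ V]
    [AddCommGroup W] [Module ℝ W]
    [NormedAddCommGroup H] [InnerProductSpace ℝ H]
    [NormedAddCommGroup K] [InnerProductSpace ℝ K] [CompleteSpace K]
    (i : V →ₗ[ℝ] H) (hi : DenseRange i) (j : W →ₗ[ℝ] K) (hj : DenseRange j)
    (f : V →ₗ[ℝ] W →ₗ[ℝ] ℝ) (C : ℝ) (hC : 0 ≤ C) (hf : ∀ x y, |f x y| ≤ C * ‖i x‖ * ‖j y‖) :
    ∃ N : H →L[ℝ] K, ∀ x y, f x y = inner ℝ (N (i x)) (j y) := by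
  have key : ∀ x, ∃ b : K, ∀ y, f x y = inner ℝ b (j y) := fun x =>
    exists_inner_eq_of_denseRange j hj (f x) (C * ‖i x‖) (hf x)
  choose b hb using key
  have hext : ∀ u v : K, (∀ y, inner ℝ u (j y) = inner ℝ v (j y)) → u = v := by
    intro u v h
    exact hj.eq_of_inner_left (𝕜 := ℝ) h
  let b' : V →ₗ[ℝ] K :=
    { toFun := b
      map_add' := fun x y => hext _ _ fun z => by
        rw [inner_add_left, ← hb, ← hb, ← hb]; simp
      map_smul' := fun r x => hext _ _ fun z => by
        rw [RingHom.id_apply, real_inner_smul_left, ← hb, ← hb]; simp }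
  have hbound : ∀ x, ‖b' x‖ ≤ C * ‖i x‖ := by
    intro x
    -- The bound passes from the dense image of `j` to all of `K`, so it can be tested at `y = b x`,
    -- which bounds the norm of `b x`.
    have h1 : ∀ y : K, |inner ℝ (b x) y| ≤ C * ‖i x‖ * ‖y‖ := by
      intro y
      refine hj.induction_on (p := fun y => |inner ℝ (b x) y| ≤ C * ‖i x‖ * ‖y‖) y ?_ ?_
      · exact isClosed_le (by fun_prop) (by fun_prop)
      · intro w
        rw [← hb]
        exact hf x w
    have h2 := h1 (b x)
    rw [real_inner_self_eq_norm_sq, abs_of_nonneg (sq_nonneg _), sq] at h2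
    rcases (norm_nonneg (b x)).eq_or_lt with h | h
    · change ‖b x‖ ≤ _
      rw [← h]
      positivity
    · exact le_of_mul_le_mul_right h2 h
  refine ⟨b'.extendOfNorm i, fun x y => ?_⟩
  rw [LinearMap.extendOfNorm_eq hi ⟨C, hbound⟩]
  exact hb x y

end HilbertRealization

/-! ### Saddle points of quadratic functionals with degenerate diagonal forms. -/

section Minimax

/-- The minimiser `x₀` may lie outside the image of `i`; density and continuity still make its value
the greatest lower bound there. -/
theorem isGLB_range_comp_of_denseRange {V X : Type*} [TopologicalSpace X] {i : V → X}
    (hi : DenseRange i) {f : X → ℝ} (hf : Continuous f) {x₀ : X} (h : ∀ x, f x₀ ≤ f x) :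
    IsGLB (Set.range fun v => f (i v)) (f x₀) := by
  refine ⟨?_, fun c hc => ?_⟩
  · rintro _ ⟨v, rfl⟩
    exact h _
  · refine hi.induction_on (p := fun x => c ≤ f x) x₀ (isClosed_le continuous_const hf) ?_
    intro v
    exact hc ⟨v, rfl⟩

theorem isLUB_range_comp_of_denseRange {V X : Type*} [TopologicalSpace X] {i : V → X}
    (hi : DenseRange i) {f : X → ℝ} (hf : Continuous f) {x₀ : X} (h : ∀ x, f x ≤ f x₀) :
    IsLUB (Set.range fun v => f (i v)) (f x₀) := by
  refine ⟨?_, fun c hc => ?_⟩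
  · rintro _ ⟨v, rfl⟩
    exact h _
  · refine hi.induction_on (p := fun x => f x ≤ c) x₀ (isClosed_le hf continuous_const) ?_
    intro v
    exact hc ⟨v, rfl⟩

/-- `1 + N* N` is onto. -/
theorem exists_add_adjoint_comp_eq {H K : Type*}
    [NormedAddCommGroup H] [InnerProductSpace ℝ H] [CompleteSpace H]
    [NormedAddCommGroup K] [InnerProductSpace ℝ K] [CompleteSpace K] (N : H →L[ℝ] K) (b : H) :
    ∃ x, x + N.adjoint (N x) = b := by
  let T : H →L[ℝ] H := ContinuousLinearMap.id ℝ H + N.adjoint ∘L N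
  let B : H →L[ℝ] H →L[ℝ] ℝ := (innerSL ℝ).comp T
  have hB : IsCoercive B := by
    refine ⟨1, one_pos, fun u => ?_⟩
    have : B u u = ‖u‖ ^ 2 + ‖N u‖ ^ 2 := by
      change inner ℝ (u + N.adjoint (N u)) u = _
      rw [inner_add_left, ContinuousLinearMap.adjoint_inner_left, real_inner_self_eq_norm_sq,
        real_inner_self_eq_norm_sq]
    rw [this]
    nlinarith [sq_nonneg ‖N u‖]
  refine ⟨hB.continuousLinearEquivOfBilin.symm b, ?_⟩
  set x := hB.continuousLinearEquivOfBilin.symm b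
  refine ext_inner_right ℝ fun w => ?_
  have h1 := hB.continuousLinearEquivOfBilin_apply x w
  rw [ContinuousLinearEquiv.apply_symm_apply] at h1
  exact h1.symm

/-- The saddle function on a product of Hilbert spaces. -/
noncomputable def saddle {H K : Type*} [NormedAddCommGroup H] [InnerProductSpace ℝ H]
    [NormedAddCommGroup K] [InnerProductSpace ℝ K] (N : H →L[ℝ] K) (b₁ : H) (b₂ : K) (c : ℝ)
    (x : H) (y : K) : ℝ :=
  ‖x‖ ^ 2 + 2 * inner ℝ (N x) y - ‖y‖ ^ 2 + 2 * inner ℝ b₁ x + 2 * inner ℝ b₂ y + c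

variable {H K : Type*} [NormedAddCommGroup H] [InnerProductSpace ℝ H]
    [NormedAddCommGroup K] [InnerProductSpace ℝ K]

/-- Completing the square in `y`: the maximiser for fixed `x` is `N x + b₂`. -/
theorem saddle_eq_sub (N : H →L[ℝ] K) (b₁ : H) (b₂ : K) (c : ℝ) (x : H) (y : K) :
    saddle N b₁ b₂ c x y =
      saddle N b₁ b₂ c x (N x + b₂) - ‖y - (N x + b₂)‖ ^ 2 := by
  unfold saddle
  simp only [← real_inner_self_eq_norm_sq, inner_add_left, inner_add_right, inner_sub_left,
    inner_sub_right]
  rw [real_inner_comm (N x) y, real_inner_comm b₂ y, real_inner_comm b₂ (N x)]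
  ring

variable [CompleteSpace H] [CompleteSpace K]

/-- Completing the square in `x`: the minimiser for fixed `y` is `-(N.adjoint y + b₁)`. -/
theorem saddle_eq_add (N : H →L[ℝ] K) (b₁ : H) (b₂ : K) (c : ℝ) (x : H) (y : K) :
    saddle N b₁ b₂ c x y =
      saddle N b₁ b₂ c (-(N.adjoint y + b₁)) y + ‖x + (N.adjoint y + b₁)‖ ^ 2 := by
  unfold saddle
  simp only [← real_inner_self_eq_norm_sq, inner_add_left, inner_add_right,
    inner_neg_right, inner_neg_left]
  have hN : ∀ u, inner ℝ (N u) y = inner ℝ (N.adjoint y) u := fun u => by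
    rw [ContinuousLinearMap.adjoint_inner_left, real_inner_comm]
  simp only [hN, inner_add_right, inner_neg_right]
  rw [real_inner_comm (N.adjoint y) x, real_inner_comm b₁ x, real_inner_comm b₁ (N.adjoint y)]
  ring

/-- Each coordinate is the best response to the other. Eliminating `y₀` leaves the equation (1 +
N*N) x₀ = -(N* b₂ + b₁). -/
theorem exists_saddle_point (N : H →L[ℝ] K) (b₁ : H) (b₂ : K) :
    ∃ x₀ y₀, y₀ = N x₀ + b₂ ∧ x₀ = -(N.adjoint y₀ + b₁) := by
  obtain ⟨x, hx⟩ := exists_add_adjoint_comp_eq N (-(N.adjoint b₂ + b₁))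
  refine ⟨x, _, rfl, ?_⟩
  rw [eq_comm, ← sub_eq_zero] at hx
  rw [← sub_eq_zero, ← neg_eq_zero, ← hx, map_add]
  abel

/-- Lets continuity of the optimal values on the completions be pulled back to the original norm
topologies. -/
theorem continuous_of_inner_self_eq {V H : Type*} [NormedAddCommGroup V] [NormedSpace ℝ V]
    [NormedAddCommGroup H] [InnerProductSpace ℝ H] (i : V →ₗ[ℝ] H) (f : V →L[ℝ] V →L[ℝ] ℝ)
    (h : ∀ x, inner ℝ (i x) (i x) = f x x) : Continuous i := by
  refine AddMonoidHomClass.continuous_of_bound i (Real.sqrt ‖f‖) fun x => ?_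
  refine le_of_sq_le_sq ?_ (by positivity)
  rw [mul_pow, Real.sq_sqrt (by positivity), ← real_inner_self_eq_norm_sq, h]
  calc f x x ≤ ‖f x x‖ := le_abs_self _
    _ ≤ ‖f‖ * ‖x‖ * ‖x‖ := f.le_opNorm₂ x x
    _ = ‖f‖ * ‖x‖ ^ 2 := by ring

/-- Minimax theorem for a convex-concave quadratic functional whose coupling and linear terms are
dominated by the (possibly degenerate) diagonal forms. -/
theorem minimax_quadratic {V W : Type*} [NormedAddCommGroup V] [NormedSpace ℝ V]
    [NormedAddCommGroup W] [NormedSpace ℝ W]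
    (f₁ : V →L[ℝ] V →L[ℝ] ℝ) (hs₁ : ∀ x y, f₁ x y = f₁ y x) (hp₁ : ∀ x, 0 ≤ f₁ x x)
    (f₂ : W →L[ℝ] W →L[ℝ] ℝ) (hs₂ : ∀ x y, f₂ x y = f₂ y x) (hp₂ : ∀ x, 0 ≤ f₂ x x)
    (m : V →L[ℝ] W →L[ℝ] ℝ) (ℓ₁ : V →L[ℝ] ℝ) (ℓ₂ : W →L[ℝ] ℝ) (c C : ℝ) (hC : 0 ≤ C)
    (hm : ∀ v w, m v w ^ 2 ≤ C ^ 2 * (f₁ v v * f₂ w w))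
    (hℓ₁ : ∀ v, ℓ₁ v ^ 2 ≤ C ^ 2 * f₁ v v) (hℓ₂ : ∀ w, ℓ₂ w ^ 2 ≤ C ^ 2 * f₂ w w)
    (g : V → W → ℝ)
    (hg : ∀ v w, g v w = f₁ v v + 2 * m v w - f₂ w w + 2 * ℓ₁ v + 2 * ℓ₂ w + c) :
    (∀ w, BddBelow (Set.range fun v => g v w)) ∧
    (∀ v, BddAbove (Set.range fun w => g v w)) ∧
    Continuous (fun w => ⨅ v, g v w) ∧
    Continuous (fun v => ⨆ w, g v w) ∧
    BddBelow (Set.range fun v => ⨆ w, g v w) ∧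
    BddAbove (Set.range fun w => ⨅ v, g v w) ∧
    (⨅ v, ⨆ w, g v w) = ⨆ w, ⨅ v, g v w := by
  obtain ⟨H, _, _, _, i, hi, hif⟩ := exists_hilbert_realization
    ((ContinuousLinearMap.coeLM ℝ).comp f₁.toLinearMap) hs₁ hp₁
  obtain ⟨K, _, _, _, j, hj, hjf⟩ := exists_hilbert_realization
    ((ContinuousLinearMap.coeLM ℝ).comp f₂.toLinearMap) hs₂ hp₂
  replace hif : ∀ x, inner ℝ (i x) (i x) = f₁ x x := fun x => hif x x
  replace hjf : ∀ x, inner ℝ (j x) (j x) = f₂ x x := fun x => hjf x x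
  have hic : Continuous i := continuous_of_inner_self_eq i f₁ hif
  have hjc : Continuous j := continuous_of_inner_self_eq j f₂ hjf
  obtain ⟨b₁, hb₁⟩ := exists_inner_eq_of_denseRange i hi ℓ₁.toLinearMap C fun v => by
    refine abs_le_of_sq_le_sq ?_ (by positivity)
    rw [mul_pow, ← real_inner_self_eq_norm_sq, hif]
    exact hℓ₁ v
  obtain ⟨b₂, hb₂⟩ := exists_inner_eq_of_denseRange j hj ℓ₂.toLinearMap C fun w => by
    refine abs_le_of_sq_le_sq ?_ (by positivity)
    rw [mul_pow, ← real_inner_self_eq_norm_sq, hjf]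
    exact hℓ₂ w
  obtain ⟨N, hN⟩ := exists_clm_inner_eq_of_denseRange i hi j hj
    ((ContinuousLinearMap.coeLM ℝ).comp m.toLinearMap) C hC fun v w => by
      refine abs_le_of_sq_le_sq ?_ (by positivity)
      rw [mul_pow, mul_pow, ← real_inner_self_eq_norm_sq, ← real_inner_self_eq_norm_sq, hif, hjf,
        mul_assoc]
      exact hm v w
  have hgs : ∀ v w, g v w = saddle N b₁ b₂ c (i v) (j w) := by
    intro v w
    have h1 : ℓ₁ v = _ := hb₁ v
    have h2 : ℓ₂ w = _ := hb₂ w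
    have h3 : m v w = _ := hN v w
    rw [hg, saddle, ← h1, ← h2, ← h3, ← real_inner_self_eq_norm_sq, ← real_inner_self_eq_norm_sq,
      hif, hjf]
  simp only [hgs]
  have hsup : ∀ x : H, IsLUB (Set.range fun w => saddle N b₁ b₂ c x (j w))
      (saddle N b₁ b₂ c x (N x + b₂)) := fun x =>
    isLUB_range_comp_of_denseRange hj (f := saddle N b₁ b₂ c x)
      (by unfold saddle; fun_prop) fun y => by
        rw [saddle_eq_sub N b₁ b₂ c x y]
        exact sub_le_self _ (sq_nonneg _)
  have hinf : ∀ y : K, IsGLB (Set.range fun v => saddle N b₁ b₂ c (i v) y)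
      (saddle N b₁ b₂ c (-(N.adjoint y + b₁)) y) := fun y =>
    isGLB_range_comp_of_denseRange hi (f := fun x => saddle N b₁ b₂ c x y)
      (by unfold saddle; fun_prop) fun x => by
        rw [saddle_eq_add N b₁ b₂ c x y]
        exact le_add_of_nonneg_right (sq_nonneg _)
  obtain ⟨x₀, y₀, hy₀, hx₀⟩ := exists_saddle_point N b₁ b₂
  -- The partial supremum at `x` is at least the value at `(x, y₀)`, hence at least the saddle
  -- value, with equality at `x₀`.
  have hleft : IsGLB (Set.range fun v => saddle N b₁ b₂ c (i v) (N (i v) + b₂))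
      (saddle N b₁ b₂ c x₀ y₀) := by
    have := isGLB_range_comp_of_denseRange hi (x₀ := x₀)
      (f := fun x => saddle N b₁ b₂ c x (N x + b₂)) (by unfold saddle; fun_prop) fun x => by
        calc saddle N b₁ b₂ c x₀ (N x₀ + b₂) = saddle N b₁ b₂ c x₀ y₀ := by rw [hy₀]
          _ ≤ saddle N b₁ b₂ c x y₀ := by
            rw [saddle_eq_add N b₁ b₂ c x y₀, ← hx₀]
            exact le_add_of_nonneg_right (sq_nonneg _)
          _ ≤ _ := by
            rw [saddle_eq_sub N b₁ b₂ c x y₀]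
            exact sub_le_self _ (sq_nonneg _)
    simpa only [← hy₀] using this
  have hright : IsLUB (Set.range fun w => saddle N b₁ b₂ c (-(N.adjoint (j w) + b₁)) (j w))
      (saddle N b₁ b₂ c x₀ y₀) := by
    have := isLUB_range_comp_of_denseRange hj (x₀ := y₀)
      (f := fun y => saddle N b₁ b₂ c (-(N.adjoint y + b₁)) y) (by unfold saddle; fun_prop)
      fun y => by
        calc _ ≤ saddle N b₁ b₂ c x₀ y := by
              rw [saddle_eq_add N b₁ b₂ c x₀ y]
              exact le_add_of_nonneg_right (sq_nonneg _)
          _ ≤ saddle N b₁ b₂ c x₀ y₀ := by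
              rw [saddle_eq_sub N b₁ b₂ c x₀ y, ← hy₀]
              exact sub_le_self _ (sq_nonneg _)
          _ = _ := by rw [← hx₀]
    simpa only [← hx₀] using this
  have hsup' := fun v => (hsup (i v)).ciSup_eq
  have hinf' := fun w => (hinf (j w)).ciInf_eq
  simp only [hsup', hinf']
  refine ⟨fun w => (hinf _).bddBelow, fun v => (hsup _).bddAbove, ?_, ?_, hleft.bddBelow,
    hright.bddAbove, ?_⟩
  · unfold saddle
    fun_prop
  · unfold saddle
    fun_prop
  · rw [hleft.ciInf_eq, hright.ciSup_eq]

end Minimax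

open Finset.HasAntidiagonal (antidiagonal)

/-! ### Schur stability: summability of the powers of A. -/

theorem map_ofReal_pow {m : Type*} [Fintype m] [DecidableEq m] (A : Matrix m m ℝ) (t : ℕ) :
    (A ^ t).map Complex.ofReal = A.map Complex.ofReal ^ t := by
  induction t with
  | zero => simp [Matrix.map_one]
  | succ t ih => rw [pow_succ, pow_succ, ← ih]; exact Matrix.map_mul (f := Complex.ofRealHom)

section Stability

attribute [local instance] Matrix.linftyOpNormedAddCommGroup Matrix.linftyOpNormedRing
  Matrix.linftyOpNormedAlgebra Matrix.linftyOpNormedSpace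

/-- Gelfand's formula: for r strictly between the spectral radius and 1, the norm of `x ^ t` is
eventually at most r ^ t. -/
theorem summable_norm_pow_of_spectralRadius_lt_one {R : Type*} [NormedRing R] [NormedAlgebra ℂ R]
    [CompleteSpace R] {x : R} (hx : spectralRadius ℂ x < 1) : Summable fun t : ℕ => ‖x ^ t‖ := by
  obtain ⟨r, hr, hr1⟩ := ENNReal.lt_iff_exists_nnreal_btwn.1 hx
  have hr1' : r < 1 := by exact_mod_cast hr1
  have hev := (spectrum.pow_nnnorm_pow_one_div_tendsto_nhds_spectralRadius x).eventually_lt_const hr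
  have hg : Summable fun t : ℕ => (r : ℝ) ^ t :=
    summable_geometric_of_lt_one r.2 (by exact_mod_cast hr1')
  refine hg.of_norm_bounded_eventually_nat ?_
  filter_upwards [hev, Filter.eventually_gt_atTop 0] with t ht ht0
  have h1 : (‖x ^ t‖₊ : ENNReal) ≤ (r : ENNReal) ^ t := by
    have h2 := ENNReal.rpow_le_rpow ht.le (Nat.cast_nonneg t)
    rw [← ENNReal.rpow_mul, one_div, inv_mul_cancel₀ (by positivity), ENNReal.rpow_one,
      ENNReal.rpow_natCast] at h2
    exact h2
  rw [norm_norm]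
  exact_mod_cast h1

theorem IsSchur.spectralRadius_lt_one {n : ℕ} {A : Matrix (Fin n) (Fin n) ℝ} (hA : IsSchur A) :
    spectralRadius ℂ (A.map Complex.ofReal) < 1 := by
  -- The spectrum is empty when `n = 0`.
  rcases (spectrum ℂ (A.map Complex.ofReal)).eq_empty_or_nonempty with h | h
  · simp [spectralRadius, h]
  · have := spectrum.spectralRadius_lt_of_forall_lt_of_nonempty (𝕜 := ℂ) h (r := 1) fun z hz => by
      by_contra hz1
      rw [not_lt] at hz1
      have hdet := hA z (by exact_mod_cast hz1)
      rw [spectrum.mem_iff, Matrix.isUnit_iff_isUnit_det, isUnit_iff_ne_zero] at hz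
      rw [Algebra.algebraMap_eq_smul_one] at hz
      exact hz hdet
    simpa using this

theorem norm_ofReal_comp {ι : Type*} [Fintype ι] (x : ι → ℝ) :
    ‖(fun i => (x i : ℂ))‖ = ‖x‖ := by
  simp [Pi.norm_def]

theorem map_ofReal_mulVec {m l : Type*} [Fintype l] (M : Matrix m l ℝ) (x : l → ℝ) :
    M.map Complex.ofReal *ᵥ (fun i => (x i : ℂ)) = fun i => ((M *ᵥ x) i : ℂ) := by
  ext i
  simp [Matrix.mulVec, dotProduct]

theorem IsSchur.exists_summable_bound {n : ℕ} {A : Matrix (Fin n) (Fin n) ℝ} (hA : IsSchur A) :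
    ∃ α : ℕ → ℝ, (∀ t, 0 ≤ α t) ∧ Summable α ∧ ∀ t x, ‖(A ^ t) *ᵥ x‖ ≤ α t * ‖x‖ := by
  have hsum : Summable fun t : ℕ => ‖A.map Complex.ofReal ^ t‖ := by
    have : CompleteSpace (Matrix (Fin n) (Fin n) ℂ) := FiniteDimensional.complete ℂ _
    exact summable_norm_pow_of_spectralRadius_lt_one hA.spectralRadius_lt_one
  refine ⟨fun t => ‖A.map Complex.ofReal ^ t‖, fun t => norm_nonneg _, hsum, fun t x => ?_⟩
  have h := Matrix.linfty_opNorm_mulVec ((A.map Complex.ofReal) ^ t) (fun i => (x i : ℂ))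
  rw [← map_ofReal_pow, map_ofReal_mulVec, norm_ofReal_comp, norm_ofReal_comp] at h
  rwa [map_ofReal_pow] at h

theorem exists_mulVec_bound {m l : Type*} [Fintype m] [Fintype l] (M : Matrix m l ℝ) :
    ∃ β : ℝ, 0 ≤ β ∧ ∀ x, ‖M *ᵥ x‖ ≤ β * ‖x‖ :=
  ⟨‖M‖, norm_nonneg _, fun x => Matrix.linfty_opNorm_mulVec M x⟩

end Stability

/-! ### Young's inequality for ℓ¹ * ℓ². -/

section Convolution

open Finset in
-- Cauchy–Schwarz with weight `α` bounds the squared convolution by the sum of `α` times the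
-- convolution of `α` with `b ^ 2`, and the latter is a product of ℓ¹ sequences.
theorem summable_convolution_sq {α b : ℕ → ℝ} (hα : ∀ t, 0 ≤ α t) (hαs : Summable α)
    (hbs : Summable fun t => b t ^ 2) :
    Summable (fun t => (∑ p ∈ antidiagonal t, α p.1 * b p.2) ^ 2) ∧
    ∑' t, (∑ p ∈ antidiagonal t, α p.1 * b p.2) ^ 2 ≤ (∑' t, α t) ^ 2 * ∑' t, b t ^ 2 := by
  have hle : ∀ t, (∑ p ∈ antidiagonal t, α p.1 * b p.2) ^ 2 ≤
      (∑' t, α t) * ∑ p ∈ antidiagonal t, α p.1 * b p.2 ^ 2 := by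
    intro t
    refine (sum_sq_le_sum_mul_sum_of_sq_le_mul (antidiagonal t) (f := fun p => α p.1)
      (g := fun p => α p.1 * b p.2 ^ 2) (fun p _ => hα _)
      (fun p _ => mul_nonneg (hα _) (sq_nonneg _)) (fun p _ => by
        exact (by ring : _ = _).le)).trans ?_
    refine mul_le_mul_of_nonneg_right ?_
      (sum_nonneg fun p _ => mul_nonneg (hα _) (sq_nonneg _))
    rw [Finset.Nat.sum_antidiagonal_eq_sum_range_succ_mk]
    exact hαs.sum_le_tsum _ fun t _ => hα t
  have hαn : Summable fun t => ‖α t‖ := hαs.norm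
  have hbn : Summable fun t => ‖b t ^ 2‖ := hbs.norm
  have hconv : Summable fun t => ∑ p ∈ antidiagonal t, α p.1 * b p.2 ^ 2 :=
    (summable_norm_sum_mul_antidiagonal_of_summable_norm hαn hbn).of_norm
  have hsum := Summable.of_nonneg_of_le (fun t => sq_nonneg _) hle (hconv.mul_left _)
  refine ⟨hsum, ?_⟩
  calc _ ≤ ∑' t, (∑' t, α t) * ∑ p ∈ antidiagonal t, α p.1 * b p.2 ^ 2 :=
        hsum.tsum_le_tsum hle (hconv.mul_left _)
    _ = _ := by
        rw [tsum_mul_left, ← tsum_mul_tsum_eq_tsum_sum_antidiagonal_of_summable_norm hαn hbn]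
        ring

end Convolution

/-! ### Linearity and ℓ¹, ℓ² bounds for trajectories. -/

section Trajectory

variable {n : ℕ} {ι : Type*} [Fintype ι]

/-- The state trajectory of `x(t+1) = A x(t) + B u(t)` with initial state `a`. -/
def traj (A : Matrix (Fin n) (Fin n) ℝ) (B : Matrix (Fin n) ι ℝ) (a : Fin n → ℝ)
    (u : ℕ → ι → ℝ) : ℕ → Fin n → ℝ
  | 0 => a
  | t + 1 => A *ᵥ traj A B a u t + B *ᵥ u t

/-- The stacked sequence of states and inputs. -/
def output (A : Matrix (Fin n) (Fin n) ℝ) (B : Matrix (Fin n) ι ℝ) (a : Fin n → ℝ)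
    (u : ℕ → ι → ℝ) (t : ℕ) : Fin n ⊕ ι → ℝ :=
  Sum.elim (traj A B a u t) (u t)

variable (A : Matrix (Fin n) (Fin n) ℝ) (B : Matrix (Fin n) ι ℝ)

theorem traj_add (a a' : Fin n → ℝ) (u u' : ℕ → ι → ℝ) (t : ℕ) :
    traj A B (a + a') (u + u') t = traj A B a u t + traj A B a' u' t := by
  induction t with
  | zero => rfl
  | succ t ih =>
    simp only [traj, ih, Matrix.mulVec_add, Pi.add_apply]
    abel

theorem traj_smul (c : ℝ) (a : Fin n → ℝ) (u : ℕ → ι → ℝ) (t : ℕ) :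
    traj A B (c • a) (c • u) t = c • traj A B a u t := by
  induction t with
  | zero => rfl
  | succ t ih =>
    simp only [traj, ih, Matrix.mulVec_smul, Pi.smul_apply, smul_add]

theorem output_add (a a' : Fin n → ℝ) (u u' : ℕ → ι → ℝ) :
    output A B (a + a') (u + u') = output A B a u + output A B a' u' := by
  ext t (i | i)
  · simp [output, traj_add]
  · simp [output]

theorem output_smul (c : ℝ) (a : Fin n → ℝ) (u : ℕ → ι → ℝ) :
    output A B (c • a) (c • u) = c • output A B a u := by
  ext t (i | i)
  · simp [output, traj_smul]
  · simp [output]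

/-- Variation of constants; it exhibits the forced response as a convolution with the powers of `A`.
-/
theorem traj_succ_eq (a : Fin n → ℝ) (u : ℕ → ι → ℝ) (t : ℕ) :
    traj A B a u (t + 1) = (A ^ (t + 1)) *ᵥ a +
      ∑ p ∈ antidiagonal t, (A ^ p.1) *ᵥ (B *ᵥ u p.2) := by
  induction t with
  | zero => simp [traj]
  | succ t ih =>
    rw [traj, ih, Finset.Nat.sum_antidiagonal_succ]
    simp only [Matrix.mulVec_add, Matrix.mulVec_mulVec, pow_zero, Matrix.one_mul,
      Matrix.mulVec_sum, ← pow_succ', ← Matrix.mul_assoc]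
    abel

variable {A}

theorem IsSchur.exists_traj_bound (hA : IsSchur A) :
    ∃ α : ℕ → ℝ, (∀ t, 0 ≤ α t) ∧ Summable α ∧ ∀ a u t,
      ‖traj A B a u (t + 1)‖ ≤
        α (t + 1) * ‖a‖ + ∑ p ∈ antidiagonal t, α p.1 * ‖u p.2‖ := by
  obtain ⟨α, hα, hαs, hαA⟩ := hA.exists_summable_bound
  obtain ⟨β, hβ, hβB⟩ := exists_mulVec_bound B
  refine ⟨fun t => (1 + β) * α t, fun t => by have := hα t; positivity, hαs.mul_left _,
    fun a u t => ?_⟩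
  rw [traj_succ_eq]
  refine (norm_add_le _ _).trans (add_le_add ?_ ((norm_sum_le _ _).trans
    (Finset.sum_le_sum fun p _ => ?_)))
  · refine (hαA _ _).trans (mul_le_mul_of_nonneg_right ?_ (norm_nonneg _))
    nlinarith [hα (t + 1)]
  · refine (hαA _ _).trans ((mul_le_mul_of_nonneg_left (hβB _) (hα _)).trans ?_)
    nlinarith [mul_nonneg (hα p.1) (norm_nonneg (u p.2))]

theorem IsSchur.summable_norm_traj (hA : IsSchur A) (a : Fin n → ℝ) {u : ℕ → ι → ℝ}
    (hu : Summable fun t => ‖u t‖) : Summable fun t => ‖traj A B a u t‖ := by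
  obtain ⟨α, hα, hαs, h⟩ := hA.exists_traj_bound B
  rw [← summable_nat_add_iff 1]
  refine Summable.of_nonneg_of_le (fun t => norm_nonneg _) (h a u) ?_
  refine (((summable_nat_add_iff 1).2 hαs).mul_right _).add ?_
  exact (summable_norm_sum_mul_antidiagonal_of_summable_norm hαs.norm hu.norm).of_norm

theorem IsSchur.exists_traj_sq_bound (hA : IsSchur A) :
    ∃ C : ℝ, 0 ≤ C ∧ ∀ a (u : ℕ → ι → ℝ), (Summable fun t => ‖u t‖ ^ 2) →
      (Summable fun t => ‖traj A B a u t‖ ^ 2) ∧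
      ∑' t, ‖traj A B a u t‖ ^ 2 ≤ C * (‖a‖ ^ 2 + ∑' t, ‖u t‖ ^ 2) := by
  obtain ⟨α, hα, hαs, h⟩ := hA.exists_traj_bound B
  have hα2 : Summable fun t => α t ^ 2 := by
    have hb : ∀ t, α t ≤ ∑' t, α t := fun t => hαs.le_tsum t fun s _ => hα s
    refine Summable.of_nonneg_of_le (fun t => sq_nonneg _) (fun t => ?_)
      (hαs.mul_left (∑' t, α t))
    rw [sq]
    exact mul_le_mul_of_nonneg_right (hb t) (hα t)
  have hα2' := (summable_nat_add_iff 1).2 hα2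
  set S := ∑' t, α (t + 1) ^ 2
  have hS : 0 ≤ S := tsum_nonneg fun t => sq_nonneg _
  set R := ∑' t, α t
  -- The 1 pays for the term `t = 0`; the factors 2 come from (x + y)² ≤ 2x² + 2y².
  refine ⟨1 + 2 * S + 2 * R ^ 2, by positivity, fun a u hu => ?_⟩
  obtain ⟨hc, hcle⟩ := summable_convolution_sq hα hαs hu
  have hle : ∀ t, ‖traj A B a u (t + 1)‖ ^ 2 ≤ 2 * (‖a‖ ^ 2 * α (t + 1) ^ 2) +
      2 * (∑ p ∈ antidiagonal t, α p.1 * ‖u p.2‖) ^ 2 := by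
    intro t
    refine (pow_le_pow_left₀ (norm_nonneg _) (h a u t) 2).trans ?_
    nlinarith [sq_nonneg (α (t + 1) * ‖a‖ - ∑ p ∈ antidiagonal t, α p.1 * ‖u p.2‖)]
  have hrhs := ((hα2'.mul_left (‖a‖ ^ 2)).mul_left 2).add (hc.mul_left 2)
  have hs := Summable.of_nonneg_of_le (fun t => sq_nonneg _) hle hrhs
  have hs' := (summable_nat_add_iff (f := fun t => ‖traj A B a u t‖ ^ 2) 1).1 hs
  refine ⟨hs', ?_⟩
  rw [hs'.tsum_eq_zero_add]
  have h1 := hs.tsum_le_tsum hle hrhs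
  rw [((hα2'.mul_left (‖a‖ ^ 2)).mul_left 2).tsum_add (hc.mul_left 2), tsum_mul_left, tsum_mul_left,
    tsum_mul_left] at h1
  have hU : 0 ≤ ∑' t, ‖u t‖ ^ 2 := tsum_nonneg fun t => sq_nonneg _
  change ‖a‖ ^ 2 + _ ≤ _
  nlinarith [mul_nonneg hS hU, mul_nonneg (sq_nonneg R) (sq_nonneg ‖a‖), sq_nonneg ‖a‖]

theorem norm_sumElim_le {m l : Type*} [Fintype m] [Fintype l] (x : m → ℝ) (y : l → ℝ) :
    ‖Sum.elim x y‖ ≤ ‖x‖ + ‖y‖ := by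
  refine (pi_norm_le_iff_of_nonneg (by positivity)).2 ?_
  rintro (i | i)
  · exact (norm_le_pi_norm x i).trans (le_add_of_nonneg_right (norm_nonneg _))
  · exact (norm_le_pi_norm y i).trans (le_add_of_nonneg_left (norm_nonneg _))

theorem norm_sumElim_sq_le {m l : Type*} [Fintype m] [Fintype l] (x : m → ℝ) (y : l → ℝ) :
    ‖Sum.elim x y‖ ^ 2 ≤ 2 * ‖x‖ ^ 2 + 2 * ‖y‖ ^ 2 := by
  refine (pow_le_pow_left₀ (norm_nonneg _) (norm_sumElim_le x y) 2).trans ?_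
  nlinarith [sq_nonneg (‖x‖ - ‖y‖)]

theorem IsSchur.summable_norm_output (hA : IsSchur A) (a : Fin n → ℝ) {u : ℕ → ι → ℝ}
    (hu : Summable fun t => ‖u t‖) : Summable fun t => ‖output A B a u t‖ :=
  Summable.of_nonneg_of_le (fun _ => norm_nonneg _) (fun _ => norm_sumElim_le _ _)
    ((hA.summable_norm_traj B a hu).add hu)

theorem IsSchur.exists_output_sq_bound (hA : IsSchur A) :
    ∃ C : ℝ, 0 ≤ C ∧ ∀ a (u : ℕ → ι → ℝ), (Summable fun t => ‖u t‖ ^ 2) →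
      (Summable fun t => ‖output A B a u t‖ ^ 2) ∧
      ∑' t, ‖output A B a u t‖ ^ 2 ≤ C * (‖a‖ ^ 2 + ∑' t, ‖u t‖ ^ 2) := by
  obtain ⟨C, hC, h⟩ := hA.exists_traj_sq_bound B
  refine ⟨2 * C + 2, by positivity, fun a u hu => ?_⟩
  obtain ⟨h1, h2⟩ := h a u hu
  have h3 := (h1.mul_left 2).add (hu.mul_left 2)
  have hs : Summable fun t => ‖output A B a u t‖ ^ 2 :=
    Summable.of_nonneg_of_le (fun _ => sq_nonneg _) (fun t => norm_sumElim_sq_le _ _) h3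
  refine ⟨hs, (hs.tsum_le_tsum (fun t => norm_sumElim_sq_le _ _) h3).trans ?_⟩
  rw [(h1.mul_left 2).tsum_add (hu.mul_left 2), tsum_mul_left, tsum_mul_left]
  nlinarith [sq_nonneg ‖a‖]

end Trajectory

/-! ### The bilinear form defined by Q on square summable sequences. -/

section OutputForm

variable {κ : Type*} [Fintype κ]

/-- The form `∑ₜ y(t)' Q y'(t)` on sequences. -/
noncomputable def outputForm (Q : Matrix κ κ ℝ) (y y' : ℕ → κ → ℝ) : ℝ :=
  ∑' t, y t ⬝ᵥ Q *ᵥ y' t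

theorem exists_dotProduct_mulVec_bound (Q : Matrix κ κ ℝ) :
    ∃ β : ℝ, 0 ≤ β ∧ ∀ x y, |x ⬝ᵥ Q *ᵥ y| ≤ β * (‖x‖ * ‖y‖) := by
  obtain ⟨β, hβ, h⟩ := exists_mulVec_bound Q
  refine ⟨Fintype.card κ * β, by positivity, fun x y => ?_⟩
  calc |x ⬝ᵥ Q *ᵥ y| ≤ ∑ i, |x i * (Q *ᵥ y) i| := Finset.abs_sum_le_sum_abs _ _
    _ ≤ ∑ _i : κ, ‖x‖ * (β * ‖y‖) := Finset.sum_le_sum fun i _ => by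
        rw [abs_mul]
        exact mul_le_mul (norm_le_pi_norm x i) ((norm_le_pi_norm _ i).trans (h y))
          (abs_nonneg _) (norm_nonneg _)
    _ = _ := by
        rw [Finset.sum_const, Finset.card_univ, nsmul_eq_mul]
        ring

theorem summable_dotProduct_mulVec (Q : Matrix κ κ ℝ) {y y' : ℕ → κ → ℝ}
    (hy : Summable fun t => ‖y t‖ ^ 2) (hy' : Summable fun t => ‖y' t‖ ^ 2) :
    Summable fun t => y t ⬝ᵥ Q *ᵥ y' t := by
  obtain ⟨β, hβ, h⟩ := exists_dotProduct_mulVec_bound Q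
  refine Summable.of_norm_bounded (g := fun t => β * (‖y t‖ ^ 2 + ‖y' t‖ ^ 2))
    ((hy.add hy').mul_left β) fun t =>
      (Real.norm_eq_abs _).trans_le ((h (y t) (y' t)).trans ?_)
  refine mul_le_mul_of_nonneg_left ?_ hβ
  nlinarith [sq_nonneg (‖y t‖ - ‖y' t‖), sq_nonneg (‖y t‖ + ‖y' t‖)]

theorem exists_outputForm_bound (Q : Matrix κ κ ℝ) :
    ∃ β : ℝ, 0 ≤ β ∧ ∀ y y' : ℕ → κ → ℝ, (Summable fun t => ‖y t‖ ^ 2) →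
      (Summable fun t => ‖y' t‖ ^ 2) →
      |outputForm Q y y'| ≤ β * (∑' t, ‖y t‖ ^ 2 + ∑' t, ‖y' t‖ ^ 2) := by
  obtain ⟨β, hβ, h⟩ := exists_dotProduct_mulVec_bound Q
  refine ⟨β, hβ, fun y y' hy hy' => ?_⟩
  rw [← hy.tsum_add hy', ← tsum_mul_left]
  refine tsum_of_norm_bounded ((hy.add hy').mul_left β).hasSum fun t =>
    (Real.norm_eq_abs _).trans_le ((h _ _).trans ?_)
  refine mul_le_mul_of_nonneg_left ?_ hβ
  nlinarith [sq_nonneg (‖y t‖ - ‖y' t‖), sq_nonneg (‖y t‖ + ‖y' t‖)]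

theorem outputForm_add_left (Q : Matrix κ κ ℝ) {y₁ y₂ y' : ℕ → κ → ℝ}
    (h₁ : Summable fun t => ‖y₁ t‖ ^ 2) (h₂ : Summable fun t => ‖y₂ t‖ ^ 2)
    (hy' : Summable fun t => ‖y' t‖ ^ 2) :
    outputForm Q (y₁ + y₂) y' = outputForm Q y₁ y' + outputForm Q y₂ y' := by
  unfold outputForm
  rw [← (summable_dotProduct_mulVec Q h₁ hy').tsum_add (summable_dotProduct_mulVec Q h₂ hy')]
  simp only [Pi.add_apply, add_dotProduct]

theorem outputForm_transpose (Q : Matrix κ κ ℝ) (y y' : ℕ → κ → ℝ) :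
    outputForm Qᵀ y y' = outputForm Q y' y := by
  unfold outputForm
  congr 1
  ext t
  rw [Matrix.mulVec_transpose, dotProduct_comm, ← Matrix.dotProduct_mulVec]

theorem outputForm_add_right (Q : Matrix κ κ ℝ) {y y₁ y₂ : ℕ → κ → ℝ}
    (hy : Summable fun t => ‖y t‖ ^ 2) (h₁ : Summable fun t => ‖y₁ t‖ ^ 2)
    (h₂ : Summable fun t => ‖y₂ t‖ ^ 2) :
    outputForm Q y (y₁ + y₂) = outputForm Q y y₁ + outputForm Q y y₂ := by
  simp only [← outputForm_transpose Q, outputForm_add_left Qᵀ h₁ h₂ hy]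

theorem outputForm_smul_left (Q : Matrix κ κ ℝ) (c : ℝ) (y y' : ℕ → κ → ℝ) :
    outputForm Q (c • y) y' = c * outputForm Q y y' := by
  unfold outputForm
  rw [← tsum_mul_left]
  simp only [Pi.smul_apply, smul_dotProduct, smul_eq_mul]

theorem outputForm_smul_right (Q : Matrix κ κ ℝ) (c : ℝ) (y y' : ℕ → κ → ℝ) :
    outputForm Q y (c • y') = c * outputForm Q y y' := by
  rw [← outputForm_transpose, outputForm_smul_left, outputForm_transpose]

end OutputForm

/-! ### Parseval's identity for generating functions of ℓ¹ sequences. -/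

section Parseval

open intervalIntegral

/-- The point of the unit circle at angle `θ`. -/
noncomputable def unitExp (θ : ℝ) : ℂ := Complex.exp (θ * Complex.I)

@[simp] theorem norm_unitExp (θ : ℝ) : ‖unitExp θ‖ = 1 := Complex.norm_exp_ofReal_mul_I θ

theorem unitExp_ne_zero (θ : ℝ) : unitExp θ ≠ 0 := Complex.exp_ne_zero _

@[fun_prop] theorem continuous_unitExp : Continuous unitExp := by
  unfold unitExp
  fun_prop

theorem integral_star_unitExp_pow_mul (s t : ℕ) :
    ∫ θ in (0 : ℝ)..2 * Real.pi, star (unitExp θ ^ t) * unitExp θ ^ s =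
      if s = t then 2 * (Real.pi : ℂ) else 0 := by
  have h : ∀ θ : ℝ, star (unitExp θ ^ t) * unitExp θ ^ s =
      Complex.exp ((((s : ℂ) - t) * Complex.I) * θ) := by
    intro θ
    rw [unitExp, ← Complex.exp_nat_mul, ← Complex.exp_nat_mul, Complex.star_def,
      ← Complex.exp_conj, ← Complex.exp_add]
    congr 1
    simp
    ring
  simp only [h]
  split_ifs with hst
  · subst hst
    simp
  · have hne : ((s : ℂ) - t) * Complex.I ≠ 0 :=
      mul_ne_zero (sub_ne_zero.2 (by exact_mod_cast hst)) Complex.I_ne_zero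
    rw [integral_exp_mul_complex hne, div_eq_zero_iff]
    left
    have : ((s : ℂ) - t) * Complex.I * ((2 * Real.pi : ℝ) : ℂ) =
        (((s : ℤ) - t : ℤ) : ℂ) * (2 * Real.pi * Complex.I) := by
      push_cast
      ring
    rw [this, Complex.exp_int_mul_two_pi_mul_I]
    simp

/-- The generating function of a sequence on the unit circle. -/
noncomputable def genFun (a : ℕ → ℂ) (θ : ℝ) : ℂ := ∑' t, a t * unitExp θ ^ t

theorem summable_mul_unitExp_pow {a : ℕ → ℂ} (ha : Summable fun t => ‖a t‖) (θ : ℝ) :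
    Summable fun t => a t * unitExp θ ^ t :=
  Summable.of_norm (by simpa using ha)

theorem continuous_genFun {a : ℕ → ℂ} (ha : Summable fun t => ‖a t‖) : Continuous (genFun a) :=
  continuous_tsum (fun t => by fun_prop) ha fun t θ => by simp

theorem hasSum_integral_mul_genFun {φ : ℝ → ℂ} (hφ : Continuous φ) {a : ℕ → ℂ}
    (ha : Summable fun t => ‖a t‖) :
    HasSum (fun t => a t * ∫ θ in (0 : ℝ)..2 * Real.pi, φ θ * unitExp θ ^ t)
      (∫ θ in (0 : ℝ)..2 * Real.pi, φ θ * genFun a θ) := by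
  have h := hasSum_integral_of_dominated_convergence (a := (0 : ℝ)) (b := 2 * Real.pi)
    (μ := MeasureTheory.volume)
    (F := fun t θ => a t * (φ θ * unitExp θ ^ t)) (f := fun θ => φ θ * genFun a θ)
    (fun t θ => ‖φ θ‖ * ‖a t‖)
    (fun t => Continuous.aestronglyMeasurable (by fun_prop))
    (fun t => .of_forall fun θ _ => by simp [mul_comm])
    (.of_forall fun θ _ => ha.mul_left _) ?_
    (.of_forall fun θ _ => ?_)
  · simpa only [integral_const_mul] using h
  · simp only [tsum_mul_left]
    exact Continuous.intervalIntegrable (by fun_prop) _ _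
  · have := ((summable_mul_unitExp_pow ha θ).hasSum).mul_left (φ θ)
    refine this.congr_fun ?_
    intro t
    ring

/-- One series is integrated termwise at a time: first against a monomial, which recovers the
coefficients `a t` by orthogonality, then against the continuous function `star (genFun a)`. -/
theorem integral_star_genFun_mul {a b : ℕ → ℂ} (ha : Summable fun t => ‖a t‖)
    (hb : Summable fun t => ‖b t‖) :
    ∫ θ in (0 : ℝ)..2 * Real.pi, star (genFun a θ) * genFun b θ =
      2 * Real.pi * ∑' t, star (a t) * b t := by
  have h1 : ∀ t, ∫ θ in (0 : ℝ)..2 * Real.pi, star (unitExp θ ^ t) * genFun a θ =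
      2 * Real.pi * a t := by
    intro t
    rw [← (hasSum_integral_mul_genFun (φ := fun θ => star (unitExp θ ^ t)) (by fun_prop) ha).tsum_eq]
    simp only [integral_star_unitExp_pow_mul, mul_ite, mul_zero, tsum_ite_eq]
    ring
  have h2 : ∀ t, ∫ θ in (0 : ℝ)..2 * Real.pi, star (genFun a θ) * unitExp θ ^ t =
      2 * Real.pi * star (a t) := by
    intro t
    have h3 := congrArg star (h1 t)
    have h4 : star (∫ θ in (0 : ℝ)..2 * Real.pi, star (unitExp θ ^ t) * genFun a θ) =
        ∫ θ in (0 : ℝ)..2 * Real.pi, star (star (unitExp θ ^ t) * genFun a θ) :=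
      (Complex.conjCLE.toContinuousLinearMap.intervalIntegral_comp_comm
        (Continuous.intervalIntegrable (by have := continuous_genFun ha; fun_prop) _ _)).symm
    rw [h4] at h3
    simp only [star_mul', star_star] at h3
    rw [show (fun θ => star (genFun a θ) * unitExp θ ^ t) =
      fun θ => unitExp θ ^ t * star (genFun a θ) from funext fun θ => mul_comm _ _, h3]
    simp
  rw [← (hasSum_integral_mul_genFun (continuous_genFun ha).star hb).tsum_eq, ← tsum_mul_left]
  refine tsum_congr fun t => ?_
  rw [h2]
  ring

end Parseval

/-! ### Parseval's identity for vector sequences and a quadratic form. -/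

section VectorParseval

variable {κ : Type*} [Fintype κ]

/-- The vector generating function of a real sequence on the unit circle. -/
noncomputable def vecGenFun (y : ℕ → κ → ℝ) (θ : ℝ) (i : κ) : ℂ :=
  genFun (fun t => (y t i : ℂ)) θ

theorem summable_norm_coord {y : ℕ → κ → ℝ} (hy : Summable fun t => ‖y t‖) (i : κ) :
    Summable fun t => ‖(y t i : ℂ)‖ :=
  Summable.of_nonneg_of_le (fun _ => norm_nonneg _)
    (fun t => by rw [Complex.norm_real]; exact norm_le_pi_norm (y t) i) hy

theorem continuous_vecGenFun {y : ℕ → κ → ℝ} (hy : Summable fun t => ‖y t‖) :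
    Continuous (vecGenFun y) :=
  continuous_pi fun i => continuous_genFun (summable_norm_coord hy i)

theorem summable_norm_sq {y : ℕ → κ → ℝ} (hy : Summable fun t => ‖y t‖) :
    Summable fun t => ‖y t‖ ^ 2 := by
  refine Summable.of_nonneg_of_le (fun _ => sq_nonneg _) (fun t => ?_)
    (hy.mul_left (∑' t, ‖y t‖))
  rw [sq]
  exact mul_le_mul_of_nonneg_right (hy.le_tsum t fun _ _ => norm_nonneg _) (norm_nonneg _)

theorem integral_vecGenFun_form (Q : Matrix κ κ ℝ) {y : ℕ → κ → ℝ}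
    (hy : Summable fun t => ‖y t‖) :
    ∫ θ in (0 : ℝ)..2 * Real.pi,
      (star (vecGenFun y θ) ⬝ᵥ Q.map Complex.ofReal *ᵥ vecGenFun y θ).re =
      2 * Real.pi * outputForm Q y y := by
  have hc := continuous_vecGenFun hy
  have hci : ∀ i, Continuous fun θ => vecGenFun y θ i := fun i => by fun_prop
  have hexp : ∀ θ, star (vecGenFun y θ) ⬝ᵥ Q.map Complex.ofReal *ᵥ vecGenFun y θ =
      ∑ i, ∑ j, (Q i j : ℂ) * (star (vecGenFun y θ i) * vecGenFun y θ j) := by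
    intro θ
    simp only [dotProduct, Matrix.mulVec, Finset.mul_sum, Matrix.map_apply, Pi.star_apply]
    refine Finset.sum_congr rfl fun i _ => Finset.sum_congr rfl fun j _ => by ring
  have hs : ∀ i j, Summable fun t => y t i * y t j := fun i j => by
    have h1 : Summable fun t => ‖y t‖ * ‖y t‖ := by simpa only [sq] using summable_norm_sq hy
    exact Summable.of_norm_bounded h1 fun t => by
      rw [norm_mul]
      exact mul_le_mul (norm_le_pi_norm _ _) (norm_le_pi_norm _ _) (norm_nonneg _) (norm_nonneg _)
  have hC : ∫ θ in (0 : ℝ)..2 * Real.pi,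
      star (vecGenFun y θ) ⬝ᵥ Q.map Complex.ofReal *ᵥ vecGenFun y θ =
      ((2 * Real.pi * outputForm Q y y : ℝ) : ℂ) := by
    simp only [hexp]
    rw [intervalIntegral.integral_finsetSum fun i _ =>
      Continuous.intervalIntegrable (by fun_prop) _ _]
    have hform : outputForm Q y y = ∑ i, ∑ j, Q i j * ∑' t, y t i * y t j := by
      unfold outputForm
      simp only [dotProduct, Matrix.mulVec, Finset.mul_sum, ← tsum_mul_left]
      rw [Summable.tsum_finsetSum fun i _ => summable_sum fun j _ => by
        simpa only [mul_left_comm] using (hs i j).mul_left (Q i j)]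
      refine Finset.sum_congr rfl fun i _ => ?_
      rw [Summable.tsum_finsetSum fun j _ => by
        simpa only [mul_left_comm] using (hs i j).mul_left (Q i j)]
      refine Finset.sum_congr rfl fun j _ => tsum_congr fun t => by ring
    rw [hform]
    push_cast
    simp only [Finset.mul_sum]
    refine Finset.sum_congr rfl fun i _ => ?_
    rw [intervalIntegral.integral_finsetSum fun i _ =>
      Continuous.intervalIntegrable (by fun_prop) _ _]
    refine Finset.sum_congr rfl fun j _ => ?_
    rw [intervalIntegral.integral_const_mul]
    have := integral_star_genFun_mul (summable_norm_coord hy i) (summable_norm_coord hy j)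
    unfold vecGenFun
    rw [this]
    simp only [Complex.star_def, Complex.conj_ofReal]
    ring
  have hre := Complex.reCLM.intervalIntegral_comp_comm (a := 0) (b := 2 * Real.pi)
    (μ := MeasureTheory.volume)
    (f := fun θ => star (vecGenFun y θ) ⬝ᵥ Q.map Complex.ofReal *ᵥ vecGenFun y θ)
    (Continuous.intervalIntegrable (by simp only [hexp]; fun_prop) _ _)
  simp only [Complex.reCLM_apply] at hre
  rw [hre, hC, Complex.ofReal_re]

end VectorParseval

/-! ### The zero-state cost as an integral of the Popov form. -/

section Popov

variable {n : ℕ} {ι : Type*} [DecidableEq ι]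

/-- `[(zI - A)⁻¹ B; I]` for a general input matrix. -/
noncomputable def inputTransfer (A : Matrix (Fin n) (Fin n) ℝ) (B : Matrix (Fin n) ι ℝ) (z : ℂ) :
    Matrix (Fin n ⊕ ι) ι ℂ :=
  Matrix.fromRows
    ((z • (1 : Matrix (Fin n) (Fin n) ℂ) - A.map Complex.ofReal)⁻¹ * B.map Complex.ofReal) 1

/-- The Popov function for a general input matrix. -/
noncomputable def inputPopov [Fintype ι] (A : Matrix (Fin n) (Fin n) ℝ) (B : Matrix (Fin n) ι ℝ)
    (Q : Matrix (Fin n ⊕ ι) (Fin n ⊕ ι) ℝ) (z : ℂ) : Matrix ι ι ℂ :=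
  (inputTransfer A B z)ᴴ * Q.map Complex.ofReal * inputTransfer A B z

variable {A : Matrix (Fin n) (Fin n) ℝ}

theorem vecGenFun_mulVec {m l : Type*} [Fintype m] [Fintype l] (M : Matrix m l ℝ) {x : ℕ → l → ℝ}
    (hx : Summable fun t => ‖x t‖) (θ : ℝ) :
    vecGenFun (fun t => M *ᵥ x t) θ = M.map Complex.ofReal *ᵥ vecGenFun x θ := by
  ext i
  simp only [vecGenFun, genFun, Matrix.mulVec, dotProduct, Matrix.map_apply, Complex.ofReal_sum,
    Complex.ofReal_mul, Finset.sum_mul, ← tsum_mul_left]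
  rw [Summable.tsum_finsetSum fun j _ => by
    simpa only [mul_assoc] using
      (summable_mul_unitExp_pow (summable_norm_coord hx j) θ).mul_left _]
  simp only [mul_assoc]

theorem vecGenFun_eq_of_zero {m : Type*} [Fintype m] {x : ℕ → m → ℝ}
    (hx : Summable fun t => ‖x t‖) (h0 : x 0 = 0) (θ : ℝ) :
    vecGenFun x θ = unitExp θ • vecGenFun (fun t => x (t + 1)) θ := by
  ext i
  simp only [vecGenFun, genFun, Pi.smul_apply, smul_eq_mul]
  rw [(summable_mul_unitExp_pow (summable_norm_coord hx i) θ).tsum_eq_zero_add, h0, ← tsum_mul_left]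
  simp only [Pi.zero_apply, Complex.ofReal_zero, zero_mul, zero_add]
  exact tsum_congr fun t => by ring

theorem vecGenFun_add {m : Type*} [Fintype m] {x y : ℕ → m → ℝ} (hx : Summable fun t => ‖x t‖)
    (hy : Summable fun t => ‖y t‖) (θ : ℝ) :
    vecGenFun (fun t => x t + y t) θ = vecGenFun x θ + vecGenFun y θ := by
  ext i
  simp only [vecGenFun, genFun, Pi.add_apply, Complex.ofReal_add, add_mul]
  exact (summable_mul_unitExp_pow (summable_norm_coord hx i) θ).tsum_add
    (summable_mul_unitExp_pow (summable_norm_coord hy i) θ)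

theorem summable_norm_mulVec {m l : Type*} [Fintype m] [Fintype l] (M : Matrix m l ℝ)
    {x : ℕ → l → ℝ} (hx : Summable fun t => ‖x t‖) : Summable fun t => ‖M *ᵥ x t‖ := by
  obtain ⟨β, -, h⟩ := exists_mulVec_bound M
  exact Summable.of_nonneg_of_le (fun _ => norm_nonneg _) (fun t => h _) (hx.mul_left β)

/-- The generating function of the recursion satisfies X = ζ(AX + BU) with ζ = `unitExp θ`.
Generating functions use powers of ζ, so the transfer function is evaluated at z = ζ⁻¹. -/
theorem IsSchur.vecGenFun_traj {ι : Type*} [Fintype ι] (hA : IsSchur A) (B : Matrix (Fin n) ι ℝ) {u : ℕ → ι → ℝ}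
    (hu : Summable fun t => ‖u t‖) (θ : ℝ) :
    vecGenFun (traj A B 0 u) θ =
      (((unitExp θ)⁻¹ • (1 : Matrix (Fin n) (Fin n) ℂ) - A.map Complex.ofReal)⁻¹ *
        B.map Complex.ofReal) *ᵥ vecGenFun u θ := by
  have hx := hA.summable_norm_traj B 0 hu
  set M := (unitExp θ)⁻¹ • (1 : Matrix (Fin n) (Fin n) ℂ) - A.map Complex.ofReal with hM
  have hdet : IsUnit M.det := isUnit_iff_ne_zero.2 (hA _ (by simp))
  have h1 : vecGenFun (traj A B 0 u) θ = unitExp θ • (A.map Complex.ofReal *ᵥ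
      vecGenFun (traj A B 0 u) θ + B.map Complex.ofReal *ᵥ vecGenFun u θ) := by
    conv_lhs => rw [vecGenFun_eq_of_zero hx rfl]
    congr 1
    rw [← vecGenFun_mulVec A hx, ← vecGenFun_mulVec B hu,
      ← vecGenFun_add (summable_norm_mulVec A hx) (summable_norm_mulVec B hu)]
    rfl
  have h2 : M *ᵥ vecGenFun (traj A B 0 u) θ = B.map Complex.ofReal *ᵥ vecGenFun u θ := by
    rw [hM, Matrix.sub_mulVec, Matrix.smul_mulVec, Matrix.one_mulVec]
    nth_rewrite 1 [h1]
    rw [inv_smul_smul₀ (unitExp_ne_zero θ)]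
    abel
  rw [← Matrix.mulVec_mulVec, ← h2, Matrix.mulVec_mulVec, Matrix.nonsing_inv_mul _ hdet,
    Matrix.one_mulVec]

variable [Fintype ι]

theorem IsSchur.vecGenFun_output (hA : IsSchur A) (B : Matrix (Fin n) ι ℝ) {u : ℕ → ι → ℝ}
    (hu : Summable fun t => ‖u t‖) (θ : ℝ) :
    vecGenFun (output A B 0 u) θ = inputTransfer A B (unitExp θ)⁻¹ *ᵥ vecGenFun u θ := by
  rw [inputTransfer, Matrix.fromRows_mulVec, ← hA.vecGenFun_traj B hu, Matrix.one_mulVec]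
  ext (i | i) <;> rfl

theorem star_mulVec_dotProduct {m l : Type*} [Fintype m] [Fintype l] (T : Matrix m l ℂ)
    (Q : Matrix m m ℂ) (x : l → ℂ) :
    star (T *ᵥ x) ⬝ᵥ Q *ᵥ (T *ᵥ x) = star x ⬝ᵥ (Tᴴ * Q * T) *ᵥ x := by
  rw [Matrix.star_mulVec, ← Matrix.dotProduct_mulVec, Matrix.mulVec_mulVec, Matrix.mulVec_mulVec,
    Matrix.mul_assoc]

theorem IsSchur.integral_inputPopov (hA : IsSchur A) (B : Matrix (Fin n) ι ℝ)
    (Q : Matrix (Fin n ⊕ ι) (Fin n ⊕ ι) ℝ) {u : ℕ → ι → ℝ} (hu : Summable fun t => ‖u t‖) :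
    ∫ θ in (0 : ℝ)..2 * Real.pi,
      (star (vecGenFun u θ) ⬝ᵥ inputPopov A B Q (unitExp θ)⁻¹ *ᵥ vecGenFun u θ).re =
      2 * Real.pi * outputForm Q (output A B 0 u) (output A B 0 u) := by
  rw [← integral_vecGenFun_form Q (hA.summable_norm_output B 0 hu)]
  simp only [hA.vecGenFun_output B hu, star_mulVec_dotProduct, inputPopov]

theorem IsSchur.continuous_inputPopov_form (hA : IsSchur A) (B : Matrix (Fin n) ι ℝ)
    (Q : Matrix (Fin n ⊕ ι) (Fin n ⊕ ι) ℝ) {u : ℕ → ι → ℝ} (hu : Summable fun t => ‖u t‖) :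
    Continuous fun θ =>
      (star (vecGenFun u θ) ⬝ᵥ inputPopov A B Q (unitExp θ)⁻¹ *ᵥ vecGenFun u θ).re := by
  have hc := continuous_vecGenFun (hA.summable_norm_output B 0 hu)
  simp only [inputPopov, ← star_mulVec_dotProduct, ← hA.vecGenFun_output B hu]
  simp only [dotProduct, Matrix.mulVec]
  fun_prop

end Popov

/-! ### The right shift acts on generating functions as multiplication by ζ. -/

section Shift

variable {ι : Type*}

/-- The right shift of a sequence. -/
def shift (ι : Type*) : Module.End ℝ (ℕ → ι → ℝ) where
  toFun u t := t.casesOn 0 u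
  map_add' u v := by
    ext (_ | t) i <;> simp
  map_smul' c u := by
    ext (_ | t) i <;> simp

theorem shift_zero (u : ℕ → ι → ℝ) : shift ι u 0 = 0 := rfl

theorem shift_succ (u : ℕ → ι → ℝ) (t : ℕ) : shift ι u (t + 1) = u t := rfl

theorem vecGenFun_const_smul (c : ℝ) (u : ℕ → ι → ℝ) (θ : ℝ) :
    vecGenFun (c • u) θ = (c : ℂ) • vecGenFun u θ := by
  ext i
  simp only [vecGenFun, genFun, Pi.smul_apply, smul_eq_mul, ← tsum_mul_left, Complex.ofReal_mul,
    mul_assoc]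

variable [Fintype ι]

theorem summable_norm_shift {u : ℕ → ι → ℝ} (hu : Summable fun t => ‖u t‖) :
    Summable fun t => ‖shift ι u t‖ :=
  (summable_nat_add_iff 1).1 (by simpa only [shift_succ] using hu)

theorem vecGenFun_shift {u : ℕ → ι → ℝ} (hu : Summable fun t => ‖u t‖) (θ : ℝ) :
    vecGenFun (shift ι u) θ = unitExp θ • vecGenFun u θ :=
  vecGenFun_eq_of_zero (summable_norm_shift hu) rfl θ

theorem summable_norm_shift_pow {u : ℕ → ι → ℝ} (hu : Summable fun t => ‖u t‖) (s : ℕ) :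
    (Summable fun t => ‖(shift ι ^ s) u t‖) ∧
      ∀ θ, vecGenFun ((shift ι ^ s) u) θ = unitExp θ ^ s • vecGenFun u θ := by
  induction s with
  | zero => simpa using hu
  | succ s ih =>
    simp only [pow_succ', Module.End.mul_apply]
    exact ⟨summable_norm_shift ih.1, fun θ => by rw [vecGenFun_shift ih.1, ih.2, smul_smul]⟩

theorem summable_norm_aeval_shift {u : ℕ → ι → ℝ} (hu : Summable fun t => ‖u t‖)
    (p : Polynomial ℝ) :
    (Summable fun t => ‖(Polynomial.aeval (shift ι) p) u t‖) ∧
      ∀ θ, vecGenFun ((Polynomial.aeval (shift ι) p) u) θ =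
        Polynomial.aeval (unitExp θ) p • vecGenFun u θ := by
  induction p using Polynomial.induction_on' with
  | add p q hp hq =>
    simp only [map_add, LinearMap.add_apply, Pi.add_apply]
    refine ⟨Summable.of_nonneg_of_le (fun _ => norm_nonneg _) (fun t => norm_add_le _ _)
      (hp.1.add hq.1), fun θ => ?_⟩
    rw [add_smul, ← hp.2, ← hq.2]
    exact vecGenFun_add hp.1 hq.1 θ
  | monomial s c =>
    simp only [Polynomial.aeval_monomial, Module.End.mul_apply, Module.algebraMap_end_apply]
    obtain ⟨h1, h2⟩ := summable_norm_shift_pow hu s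
    refine ⟨by simpa only [Pi.smul_apply, norm_smul] using h1.mul_left ‖c‖, fun θ => ?_⟩
    rw [vecGenFun_const_smul, h2, smul_smul]
    rfl

end Shift

/-! ### Lower bound of a semidefinite matrix through its determinant. -/

section PosSemidefDet

variable {κ : Type*} [Fintype κ]

open scoped MatrixOrder in
-- Factor M = R*R and apply Cauchy–Schwarz to column `i` of R and the vector Rξ.
theorem norm_mulVec_sq_le_of_posSemidef {M : Matrix κ κ ℂ} (hM : M.PosSemidef) (ξ : κ → ℂ)
    (i : κ) : ‖(M *ᵥ ξ) i‖ ^ 2 ≤ ‖M i i‖ * (star ξ ⬝ᵥ M *ᵥ ξ).re := by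
  classical
  obtain ⟨R, rfl⟩ := (CStarAlgebra.nonneg_iff_eq_star_mul_self (a := M)).1 hM.nonneg
  rw [star_eq_conjTranspose]
  have h1 : (star ξ ⬝ᵥ (Rᴴ * R) *ᵥ ξ).re = ∑ l, ‖(R *ᵥ ξ) l‖ ^ 2 := by
    rw [← Matrix.mulVec_mulVec, Matrix.dotProduct_mulVec, ← Matrix.star_mulVec, dotProduct,
      Complex.re_sum]
    refine Finset.sum_congr rfl fun l _ => ?_
    rw [Pi.star_apply, Complex.star_def, ← Complex.normSq_eq_conj_mul_self, Complex.ofReal_re,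
      Complex.normSq_eq_norm_sq]
  have h2 : ∑ l, ‖R l i‖ ^ 2 ≤ ‖(Rᴴ * R) i i‖ := by
    refine le_trans (le_of_eq ?_) (Complex.re_le_norm _)
    rw [Matrix.mul_apply, Complex.re_sum]
    refine Finset.sum_congr rfl fun l _ => ?_
    rw [Matrix.conjTranspose_apply, Complex.star_def, ← Complex.normSq_eq_conj_mul_self,
      Complex.ofReal_re, Complex.normSq_eq_norm_sq]
  have h3 : ‖((Rᴴ * R) *ᵥ ξ) i‖ ≤ ∑ l, ‖R l i‖ * ‖(R *ᵥ ξ) l‖ := by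
    rw [← Matrix.mulVec_mulVec]
    refine (norm_sum_le _ _).trans (le_of_eq (Finset.sum_congr rfl fun l _ => ?_))
    rw [norm_mul]
    change ‖star (R l i)‖ * _ = _
    rw [norm_star]
  calc _ ≤ (∑ l, ‖R l i‖ * ‖(R *ᵥ ξ) l‖) ^ 2 := pow_le_pow_left₀ (norm_nonneg _) h3 2
    _ ≤ (∑ l, ‖R l i‖ ^ 2) * ∑ l, ‖(R *ᵥ ξ) l‖ ^ 2 := Finset.sum_mul_sq_le_sq_mul_sq _ _ _
    _ ≤ _ := by
      rw [h1]
      exact mul_le_mul_of_nonneg_right h2 (Finset.sum_nonneg fun _ _ => sq_nonneg _)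

variable [DecidableEq κ]

/-- Since det(M) ξ = adj(M) Mξ, a bound on Mξ by the quadratic form yields one on ξ, at the price of
the determinant. Nothing is lost where M is singular, as the left side vanishes there. -/
theorem norm_det_sq_mul_le_of_posSemidef {M : Matrix κ κ ℂ} (hM : M.PosSemidef) {K : ℝ}
    (hadj : ∀ i j, ‖M.adjugate i j‖ ≤ K) (hdiag : ∀ i, ‖M i i‖ ≤ K) (ξ : κ → ℂ) (i : κ) :
    ‖M.det‖ ^ 2 * ‖ξ i‖ ^ 2 ≤
      (Fintype.card κ : ℝ) ^ 2 * K ^ 3 * (star ξ ⬝ᵥ M *ᵥ ξ).re := by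
  have hK : 0 ≤ K := (norm_nonneg _).trans (hdiag i)
  set q := (star ξ ⬝ᵥ M *ᵥ ξ).re
  have hq : 0 ≤ q := hM.re_dotProduct_nonneg ξ
  have h1 : M.det * ξ i = ∑ j, M.adjugate i j * (M *ᵥ ξ) j := by
    have := congrFun (congrArg (· *ᵥ ξ) (Matrix.adjugate_mul M)) i
    simp only [← Matrix.mulVec_mulVec, Matrix.smul_mulVec, Matrix.one_mulVec] at this
    exact this.symm
  have h2 : ‖M.det * ξ i‖ ≤ ∑ j, K * ‖(M *ᵥ ξ) j‖ := by
    rw [h1]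
    refine (norm_sum_le _ _).trans (Finset.sum_le_sum fun j _ => ?_)
    rw [norm_mul]
    exact mul_le_mul_of_nonneg_right (hadj i j) (norm_nonneg _)
  rw [← mul_pow, ← norm_mul]
  calc _ ≤ (∑ j, K * ‖(M *ᵥ ξ) j‖) ^ 2 := pow_le_pow_left₀ (norm_nonneg _) h2 2
    _ ≤ Fintype.card κ * ∑ j, (K * ‖(M *ᵥ ξ) j‖) ^ 2 := sq_sum_le_card_mul_sum_sq
    _ ≤ Fintype.card κ * ∑ _j : κ, K ^ 2 * (K * q) := by
        refine mul_le_mul_of_nonneg_left (Finset.sum_le_sum fun j _ => ?_) (Nat.cast_nonneg _)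
        rw [mul_pow]
        refine mul_le_mul_of_nonneg_left ?_ (sq_nonneg _)
        exact (norm_mulVec_sq_le_of_posSemidef hM ξ j).trans
          (mul_le_mul_of_nonneg_right (hdiag j) hq)
    _ = _ := by
        rw [Finset.sum_const, Finset.card_univ, nsmul_eq_mul]
        ring

end PosSemidefDet

/-! ### Polynomial minorant of the Popov function, coprime to the characteristic polynomial. -/

section CirclePolynomial

open Polynomial

/-- Divide out the gcd with χ repeatedly; each nontrivial gcd lowers the degree and divides χ. -/
theorem exists_coprime_factor {F : Type*} [Field F] (χ : F[X]) (D : F[X]) (hD : D ≠ 0) :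
    ∃ p r : F[X], D = p * r ∧ IsCoprime p χ ∧ ∃ m, r ∣ χ ^ m := by
  classical
  induction h : D.natDegree using Nat.strong_induction_on generalizing D with
  | _ d ih =>
    by_cases hc : IsCoprime D χ
    · exact ⟨D, 1, (mul_one D).symm, hc, 0, one_dvd _⟩
    · obtain ⟨D', hD'⟩ := EuclideanDomain.gcd_dvd_left D χ
      set g := EuclideanDomain.gcd D χ with hg
      have hg0 : g ≠ 0 := fun h0 => hD (by rw [hD', h0, zero_mul])
      have hD'0 : D' ≠ 0 := fun h0 => hD (by rw [hD', h0, mul_zero])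
      have hgu : ¬IsUnit g := fun hu => hc (EuclideanDomain.gcd_isUnit_iff.1 hu)
      have hdeg : 0 < g.natDegree := Nat.pos_of_ne_zero fun h0 =>
        hgu (Polynomial.isUnit_iff_degree_eq_zero.2 (by
          rw [Polynomial.degree_eq_natDegree hg0, h0]; rfl))
      obtain ⟨p, r, hpr, hp, m, hm⟩ := ih D'.natDegree (by
        rw [← h, hD', Polynomial.natDegree_mul hg0 hD'0]
        omega) D' hD'0 rfl
      refine ⟨p, g * r, ?_, hp, m + 1, ?_⟩
      · rw [hD', hpr]
        ring
      · rw [pow_succ']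
        exact mul_dvd_mul (EuclideanDomain.gcd_dvd_right D χ) hm

/-- Evaluate a Bézout identity at `A` and use Cayley–Hamilton. -/
theorem isUnit_aeval_of_isCoprime_charpoly {n : ℕ} (A : Matrix (Fin n) (Fin n) ℝ) {p : ℝ[X]}
    (hp : IsCoprime p A.charpoly) : IsUnit (aeval A p) := by
  obtain ⟨a, b, hab⟩ := hp
  have h := congrArg (aeval A) hab
  rw [map_add, map_mul, map_mul, Matrix.aeval_self_charpoly, mul_zero, add_zero, map_one] at h
  exact (Matrix.isUnit_iff_isUnit_det _).2 (Matrix.isUnit_det_of_left_inverse h)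

/-- On the circle conjugation is inversion, so the reversed polynomial represents the conjugate up
to a unimodular factor. This makes the adjoint in the Popov function polynomial. -/
theorem aeval_reflect_of_norm_eq_one {f : ℝ[X]} {d : ℕ} (hf : f.natDegree ≤ d) {z : ℂ}
    (hz : ‖z‖ = 1) : aeval z (f.reflect d) = z ^ d * star (aeval z f) := by
  have hz0 : z ≠ 0 := by
    rintro rfl
    simp at hz
  have hinv : star z = z⁻¹ := by
    rw [Complex.inv_def, Complex.normSq_eq_norm_sq, hz]
    simp
  let _ : Invertible z⁻¹ := ⟨z, mul_inv_cancel₀ hz0, inv_mul_cancel₀ hz0⟩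
  have h := Polynomial.eval₂_reflect_mul_pow (algebraMap ℝ ℂ) z⁻¹ d f hf
  have h2 : star (aeval z f) = aeval z⁻¹ f := by
    rw [← hinv, Complex.star_def, Polynomial.aeval_conj]
  rw [h2, aeval_def, aeval_def, ← h]
  change _ = z ^ d * (eval₂ (algebraMap ℝ ℂ) z _ * z⁻¹ ^ d)
  rw [mul_left_comm, ← mul_pow, mul_inv_cancel₀ hz0, one_pow, mul_one]

theorem norm_aeval_inv_of_norm_eq_one (f : ℝ[X]) {z : ℂ} (hz : ‖z‖ = 1) :
    ‖aeval z⁻¹ f‖ = ‖aeval z f‖ := by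
  have hinv : z⁻¹ = starRingEnd ℂ z := by
    rw [Complex.inv_def, Complex.normSq_eq_norm_sq, hz]
    simp
  rw [hinv, Polynomial.aeval_conj, RCLike.norm_conj]

variable {n : ℕ} {ι : Type*} [DecidableEq ι]

theorem charmatrix_map_aeval (A : Matrix (Fin n) (Fin n) ℝ) (z : ℂ) :
    (charmatrix A).map (aeval z) = z • (1 : Matrix (Fin n) (Fin n) ℂ) - A.map Complex.ofReal := by
  ext i j
  by_cases h : i = j
  · subst h
    simp
  · simp [h]

theorem aeval_charpoly (A : Matrix (Fin n) (Fin n) ℝ) (z : ℂ) :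
    aeval z A.charpoly = (z • (1 : Matrix (Fin n) (Fin n) ℂ) - A.map Complex.ofReal).det := by
  rw [← charmatrix_map_aeval, Matrix.charpoly]
  exact (aeval z : ℝ[X] →ₐ[ℝ] ℂ).map_det _

/-- The numerator of `inputTransfer` over the common denominator `charpoly A`. -/
noncomputable def transferNumerator (A : Matrix (Fin n) (Fin n) ℝ) (B : Matrix (Fin n) ι ℝ) :
    Matrix (Fin n ⊕ ι) ι ℝ[X] :=
  Matrix.fromRows ((charmatrix A).adjugate * B.map C) (A.charpoly • 1)

theorem transferNumerator_map_aeval {A : Matrix (Fin n) (Fin n) ℝ} (hA : IsSchur A)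
    (B : Matrix (Fin n) ι ℝ) {z : ℂ} (hz : 1 ≤ ‖z‖) :
    (transferNumerator A B).map (aeval z) = aeval z A.charpoly • inputTransfer A B z := by
  have hdet := hA z hz
  ext (i | i) j
  · have h1 : ((charmatrix A).adjugate * B.map C).map (aeval z) =
        (z • (1 : Matrix (Fin n) (Fin n) ℂ) - A.map Complex.ofReal).adjugate *
          B.map Complex.ofReal := by
      rw [← charmatrix_map_aeval, Matrix.map_mul]
      congr 1
      · exact (aeval z : ℝ[X] →ₐ[ℝ] ℂ).map_adjugate _
      · ext i j
        simp
    have h2 := congrFun (congrFun h1 i) j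
    simp only [Matrix.map_apply, transferNumerator, inputTransfer, Matrix.fromRows_apply_inl,
      Matrix.smul_apply] at h2 ⊢
    rw [h2, Matrix.inv_def, Ring.inverse_eq_inv', Matrix.smul_mul, Matrix.smul_apply, smul_smul,
      aeval_charpoly, mul_inv_cancel₀ hdet, one_smul]
  · simp only [Matrix.map_apply, transferNumerator, inputTransfer, Matrix.fromRows_apply_inr,
      Matrix.smul_apply, smul_eq_mul, map_mul]
    by_cases h : i = j
    · subst h
      simp
    · simp [h]

variable [Fintype ι]

/-- Clear denominators: multiplying the transfer matrix by the characteristic polynomial scales the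
Popov matrix by its squared modulus. -/
theorem exists_polynomial_det_inputPopov {A : Matrix (Fin n) (Fin n) ℝ} (hA : IsSchur A)
    (B : Matrix (Fin n) ι ℝ) (Q : Matrix (Fin n ⊕ ι) (Fin n ⊕ ι) ℝ) :
    ∃ D : ℝ[X], ∀ z : ℂ, ‖z‖ = 1 →
      ‖aeval z D‖ = (‖aeval z A.charpoly‖ ^ 2) ^ Fintype.card ι * ‖(inputPopov A B Q z).det‖ := by
  set N := transferNumerator A B
  -- A common degree bound, so that reflection multiplies every entry by the same `z ^ d`.
  set d := Finset.univ.sup fun ij : (Fin n ⊕ ι) × ι => (N ij.1 ij.2).natDegree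
  have hd : ∀ i j, (N i j).natDegree ≤ d := fun i j =>
    Finset.le_sup (f := fun ij : (Fin n ⊕ ι) × ι => (N ij.1 ij.2).natDegree)
      (Finset.mem_univ (i, j))
  refine ⟨((N.map (reflect d))ᵀ * Q.map C * N).det, fun z hz => ?_⟩
  have hN := transferNumerator_map_aeval hA B hz.ge
  have h1 : ((N.map (reflect d))ᵀ).map (aeval z) = z ^ d • (N.map (aeval z))ᴴ := by
    ext i j
    simp only [Matrix.map_apply, Matrix.transpose_apply, Matrix.smul_apply,
      Matrix.conjTranspose_apply, smul_eq_mul]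
    exact aeval_reflect_of_norm_eq_one (hd j i) hz
  have h2 : ((N.map (reflect d))ᵀ * Q.map C * N).map (aeval z) =
      (z ^ d * (star (aeval z A.charpoly) * aeval z A.charpoly)) • inputPopov A B Q z := by
    rw [Matrix.map_mul, Matrix.map_mul, h1, hN, Matrix.conjTranspose_smul]
    have h3 : (Q.map C).map (aeval z) = Q.map Complex.ofReal := by
      ext i j
      simp
    rw [h3, inputPopov]
    simp only [Matrix.smul_mul, Matrix.mul_smul, smul_smul]
    congr 1
    ring
  have h4 : aeval z ((N.map (reflect d))ᵀ * Q.map C * N).det =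
      (((N.map (reflect d))ᵀ * Q.map C * N).map (aeval z)).det :=
    (aeval z : ℝ[X] →ₐ[ℝ] ℂ).map_det _
  rw [h4, h2, Matrix.det_smul, norm_mul, norm_pow, norm_mul, norm_mul, norm_pow, hz, one_pow,
    one_mul, norm_star, sq]

theorem exists_bound_of_continuous_circle {f : Metric.sphere (0 : ℂ) 1 → ℂ} (hf : Continuous f) :
    ∃ K : ℝ, ∀ z, ‖f z‖ ≤ K := by
  obtain ⟨K, hK⟩ := isCompact_univ.exists_bound_of_continuousOn hf.continuousOn
  exact ⟨K, fun z => hK z (Set.mem_univ z)⟩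

theorem exists_matrix_bound_of_continuous_circle {m l : Type*} [Finite m] [Finite l]
    {f : Metric.sphere (0 : ℂ) 1 → Matrix m l ℂ} (hf : Continuous f) :
    ∃ K : ℝ, ∀ z i j, ‖f z i j‖ ≤ K := by
  have := Fintype.ofFinite m
  have := Fintype.ofFinite l
  choose K hK using fun (ij : m × l) =>
    exists_bound_of_continuous_circle (hf.matrix_elem ij.1 ij.2)
  refine ⟨∑ ij, |K ij|, fun z i j => (hK (i, j) z).trans ((le_abs_self _).trans ?_)⟩
  exact Finset.single_le_sum (f := fun ij => |K ij|) (fun _ _ => abs_nonneg _) (Finset.mem_univ _)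

theorem IsSchur.continuous_inputPopov {A : Matrix (Fin n) (Fin n) ℝ} (hA : IsSchur A)
    (B : Matrix (Fin n) ι ℝ) (Q : Matrix (Fin n ⊕ ι) (Fin n ⊕ ι) ℝ) :
    Continuous fun z : Metric.sphere (0 : ℂ) 1 => inputPopov A B Q z := by
  have h1 : Continuous fun z : Metric.sphere (0 : ℂ) 1 =>
      (z : ℂ) • (1 : Matrix (Fin n) (Fin n) ℂ) - A.map Complex.ofReal := by fun_prop
  have h2 : Continuous fun z : Metric.sphere (0 : ℂ) 1 =>
      ((z : ℂ) • (1 : Matrix (Fin n) (Fin n) ℂ) - A.map Complex.ofReal)⁻¹ := by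
    simp only [Matrix.inv_def, Ring.inverse_eq_inv']
    exact (h1.matrix_det.inv₀ fun z => hA z (by simp)).smul h1.matrix_adjugate
  have h3 : Continuous fun z : Metric.sphere (0 : ℂ) 1 => inputTransfer A B z := by
    refine continuous_matrix ?_
    rintro (i | i) j
    · exact (h2.matrix_mul continuous_const).matrix_elem i j
    · exact continuous_const
  exact ((h3.matrix_conjTranspose).matrix_mul continuous_const).matrix_mul h3

/-- A Popov function that is positive semidefinite on the circle and definite somewhere on it is
bounded below by the squared modulus of a polynomial that is invertible at `A`. -/
theorem IsSchur.exists_polynomial_lower_bound {A : Matrix (Fin n) (Fin n) ℝ} (hA : IsSchur A)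
    (B : Matrix (Fin n) ι ℝ) (Q : Matrix (Fin n ⊕ ι) (Fin n ⊕ ι) ℝ)
    (hfreq : ∀ z : ℂ, ‖z‖ = 1 → (inputPopov A B Q z).PosSemidef)
    {z₀ : ℂ} (hz₀ : ‖z₀‖ = 1) (hpos : (inputPopov A B Q z₀).PosDef) :
    ∃ (p : ℝ[X]) (K : ℝ), IsUnit (aeval A p) ∧ 0 ≤ K ∧ ∀ z : ℂ, ‖z‖ = 1 → ∀ (ξ : ι → ℂ) (i : ι),
      ‖aeval z p‖ ^ 2 * ‖ξ i‖ ^ 2 ≤ K * (star ξ ⬝ᵥ inputPopov A B Q z *ᵥ ξ).re := by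
  obtain ⟨D, hD⟩ := exists_polynomial_det_inputPopov hA B Q
  have hχ : ∀ z : ℂ, ‖z‖ = 1 → aeval z A.charpoly ≠ 0 := fun z hz => by
    rw [aeval_charpoly]
    exact hA z hz.ge
  have hD0 : D ≠ 0 := by
    rintro rfl
    have h := hD z₀ hz₀
    rw [map_zero, norm_zero, eq_comm, mul_eq_zero, norm_eq_zero] at h
    rcases h with h | h
    · exact hχ z₀ hz₀ (norm_eq_zero.1 (pow_eq_zero_iff two_ne_zero |>.1 (eq_zero_of_pow_eq_zero h)))
    · exact hpos.det_pos.ne' h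
  -- The discarded factor `r` divides a power of the characteristic polynomial, which has no zero on
  -- the circle, so dropping it costs only a constant.
  obtain ⟨p, r, hpr, hp, m, hr⟩ := exists_coprime_factor A.charpoly D hD0
  have hr0 : ∀ z : ℂ, ‖z‖ = 1 → aeval z r ≠ 0 := fun z hz h0 => by
    have h := map_dvd (aeval z) hr
    rw [h0, zero_dvd_iff, map_pow] at h
    exact hχ z hz (eq_zero_of_pow_eq_zero h)
  have hcont : ∀ f : ℝ[X], Continuous fun z : Metric.sphere (0 : ℂ) 1 => aeval (z : ℂ) f :=
    fun f => f.continuous_aeval.comp continuous_subtype_val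
  obtain ⟨K₁, hK₁⟩ := exists_bound_of_continuous_circle
    (f := fun z => (aeval (z : ℂ) r)⁻¹) ((hcont r).inv₀ fun z => hr0 z (by simp))
  obtain ⟨K₂, hK₂⟩ := exists_bound_of_continuous_circle
    (f := fun z => (aeval (z : ℂ) A.charpoly ^ 2) ^ Fintype.card ι)
    (((hcont A.charpoly).pow 2).pow _)
  have hcP := hA.continuous_inputPopov B Q
  obtain ⟨K₃, hK₃⟩ := exists_matrix_bound_of_continuous_circle hcP
  obtain ⟨K₄, hK₄⟩ := exists_matrix_bound_of_continuous_circle hcP.matrix_adjugate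
  -- The 0 keeps the constant nonnegative also when `ι` is empty.
  set K₅ := max (max K₃ K₄) 0
  have hK₅ : 0 ≤ K₅ := le_max_right _ _
  refine ⟨p, (K₁ * K₂) ^ 2 * ((Fintype.card ι : ℝ) ^ 2 * K₅ ^ 3),
    isUnit_aeval_of_isCoprime_charpoly A hp, by positivity, fun z hz ξ i => ?_⟩
  have hzm : z ∈ Metric.sphere (0 : ℂ) 1 := by simpa using hz
  have h1 : ‖aeval z p‖ ≤ K₁ * K₂ * ‖(inputPopov A B Q z).det‖ := by
    have h2 : ‖aeval z p‖ = ‖(aeval z r)⁻¹‖ * ‖aeval z D‖ := by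
      rw [hpr, map_mul, ← norm_mul, mul_comm (aeval z p), inv_mul_cancel_left₀ (hr0 z hz)]
    have h3 := hK₁ ⟨z, hzm⟩
    have h4 := hK₂ ⟨z, hzm⟩
    rw [norm_pow, norm_pow] at h4
    rw [h2, hD z hz, ← mul_assoc]
    refine mul_le_mul_of_nonneg_right ?_ (norm_nonneg _)
    exact mul_le_mul h3 h4 (by positivity) ((norm_nonneg _).trans h3)
  have h5 := norm_det_sq_mul_le_of_posSemidef (hfreq z hz) (K := K₅)
    (fun i j => (hK₄ ⟨z, hzm⟩ i j).trans ((le_max_right _ _).trans (le_max_left _ _)))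
    (fun i => (hK₃ ⟨z, hzm⟩ i i).trans ((le_max_left _ _).trans (le_max_left _ _))) ξ i
  calc ‖aeval z p‖ ^ 2 * ‖ξ i‖ ^ 2
      ≤ (K₁ * K₂ * ‖(inputPopov A B Q z).det‖) ^ 2 * ‖ξ i‖ ^ 2 :=
        mul_le_mul_of_nonneg_right (pow_le_pow_left₀ (norm_nonneg _) h1 2) (sq_nonneg _)
    _ = (K₁ * K₂) ^ 2 * (‖(inputPopov A B Q z).det‖ ^ 2 * ‖ξ i‖ ^ 2) := by ring
    _ ≤ _ := by
        rw [mul_assoc]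
        exact mul_le_mul_of_nonneg_left h5 (sq_nonneg _)

end CirclePolynomial

/-! ### Pairing of the free response with forced responses. -/

section FreeResponse

variable {n : ℕ} {ι : Type*} [Fintype ι]

theorem output_shift_zero (A : Matrix (Fin n) (Fin n) ℝ) (B : Matrix (Fin n) ι ℝ)
    (u : ℕ → ι → ℝ) : output A B 0 (shift ι u) 0 = 0 := by
  ext (i | i) <;> rfl

theorem traj_shift_succ (A : Matrix (Fin n) (Fin n) ℝ) (B : Matrix (Fin n) ι ℝ)
    (u : ℕ → ι → ℝ) (t : ℕ) : traj A B 0 (shift ι u) (t + 1) = traj A B 0 u t := by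
  induction t with
  | zero => simp [traj, shift_zero]
  | succ t ih => rw [traj, ih, shift_succ, traj]

theorem output_shift_succ (A : Matrix (Fin n) (Fin n) ℝ) (B : Matrix (Fin n) ι ℝ)
    (u : ℕ → ι → ℝ) (t : ℕ) : output A B 0 (shift ι u) (t + 1) = output A B 0 u t := by
  rw [output, traj_shift_succ, shift_succ, output]

theorem traj_free_succ (A : Matrix (Fin n) (Fin n) ℝ) (B : Matrix (Fin n) ι ℝ)
    (a : Fin n → ℝ) (t : ℕ) : traj A B a 0 (t + 1) = traj A B (A *ᵥ a) 0 t := by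
  induction t with
  | zero => simp [traj]
  | succ t ih => rw [traj, ih, traj]; rfl

theorem output_free_succ (A : Matrix (Fin n) (Fin n) ℝ) (B : Matrix (Fin n) ι ℝ)
    (a : Fin n → ℝ) (t : ℕ) : output A B a 0 (t + 1) = output A B (A *ᵥ a) 0 t := by
  rw [output, traj_free_succ, output]
  rfl

theorem output_add_input (A : Matrix (Fin n) (Fin n) ℝ) (B : Matrix (Fin n) ι ℝ)
    (u u' : ℕ → ι → ℝ) : output A B 0 (u + u') = output A B 0 u + output A B 0 u' := by
  rw [← output_add, add_zero]

theorem output_smul_input (A : Matrix (Fin n) (Fin n) ℝ) (B : Matrix (Fin n) ι ℝ) (c : ℝ)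
    (u : ℕ → ι → ℝ) : output A B 0 (c • u) = c • output A B 0 u := by
  rw [← output_smul, smul_zero]

theorem output_add_initial (A : Matrix (Fin n) (Fin n) ℝ) (B : Matrix (Fin n) ι ℝ)
    (a a' : Fin n → ℝ) : output A B (a + a') 0 = output A B a 0 + output A B a' 0 := by
  rw [← output_add, add_zero]

theorem output_smul_initial (A : Matrix (Fin n) (Fin n) ℝ) (B : Matrix (Fin n) ι ℝ) (c : ℝ)
    (a : Fin n → ℝ) : output A B (c • a) 0 = c • output A B a 0 := by
  rw [← output_smul, smul_zero]

variable {A : Matrix (Fin n) (Fin n) ℝ} (hA : IsSchur A) (B : Matrix (Fin n) ι ℝ)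
include hA

theorem IsSchur.summable_norm_sq_output (a : Fin n → ℝ) {u : ℕ → ι → ℝ}
    (hu : Summable fun t => ‖u t‖ ^ 2) : Summable fun t => ‖output A B a u t‖ ^ 2 := by
  obtain ⟨C, -, h⟩ := hA.exists_output_sq_bound B
  exact (h a u hu).1

theorem IsSchur.summable_norm_sq_output_free (a : Fin n → ℝ) :
    Summable fun t => ‖output A B a 0 t‖ ^ 2 :=
  hA.summable_norm_sq_output B a (by simp)

/-- The pairing of the free response with a forced response intertwines the shift with `A`. -/
theorem IsSchur.outputForm_free_shift (Q : Matrix (Fin n ⊕ ι) (Fin n ⊕ ι) ℝ) (a : Fin n → ℝ)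
    {u : ℕ → ι → ℝ} (hu : Summable fun t => ‖u t‖) :
    outputForm Q (output A B a 0) (output A B 0 (shift ι u)) =
      outputForm Q (output A B (A *ᵥ a) 0) (output A B 0 u) := by
  have hs := summable_dotProduct_mulVec Q (hA.summable_norm_sq_output_free B a)
    (hA.summable_norm_sq_output B 0 (summable_norm_sq (summable_norm_shift hu)))
  unfold outputForm
  rw [hs.tsum_eq_zero_add, output_shift_zero, Matrix.mulVec_zero, dotProduct_zero, zero_add]
  simp only [output_shift_succ, output_free_succ]

theorem IsSchur.outputForm_free_shift_pow (Q : Matrix (Fin n ⊕ ι) (Fin n ⊕ ι) ℝ)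
    (a : Fin n → ℝ) {u : ℕ → ι → ℝ} (hu : Summable fun t => ‖u t‖) (s : ℕ) :
    outputForm Q (output A B a 0) (output A B 0 ((shift ι ^ s) u)) =
      outputForm Q (output A B ((A ^ s) *ᵥ a) 0) (output A B 0 u) := by
  induction s generalizing a with
  | zero => simp
  | succ s ih =>
    rw [pow_succ', Module.End.mul_apply,
      hA.outputForm_free_shift B Q a (summable_norm_shift_pow hu s).1, ih, Matrix.mulVec_mulVec,
      ← pow_succ]

/-- A polynomial in the shift on the input side moves to the same polynomial in `A` on the initial
state. For invertible p(A), every initial state can thus be traded for p(S) acting on the input. -/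
theorem IsSchur.outputForm_free_aeval (Q : Matrix (Fin n ⊕ ι) (Fin n ⊕ ι) ℝ)
    (a : Fin n → ℝ) {u : ℕ → ι → ℝ} (hu : Summable fun t => ‖u t‖) (p : Polynomial ℝ) :
    outputForm Q (output A B a 0) (output A B 0 (Polynomial.aeval (shift ι) p u)) =
      outputForm Q (output A B (Polynomial.aeval A p *ᵥ a) 0) (output A B 0 u) := by
  have hsq : ∀ u : ℕ → ι → ℝ, (Summable fun t => ‖u t‖) →
      Summable fun t => ‖output A B 0 u t‖ ^ 2 := fun u hu =>
    hA.summable_norm_sq_output B 0 (summable_norm_sq hu)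
  have hfree := hA.summable_norm_sq_output_free B
  induction p using Polynomial.induction_on' with
  | add p q hp hq =>
    rw [map_add, map_add, LinearMap.add_apply, output_add_input, Matrix.add_mulVec,
      output_add_initial, outputForm_add_left Q (hfree _) (hfree _) (hsq u hu),
      outputForm_add_right Q (hfree _) (hsq _ (summable_norm_aeval_shift hu p).1)
        (hsq _ (summable_norm_aeval_shift hu q).1), hp, hq]
  | monomial s c =>
    rw [Polynomial.aeval_monomial, Polynomial.aeval_monomial, Module.End.mul_apply,
      Module.algebraMap_end_apply, output_smul_input, outputForm_smul_right,
      hA.outputForm_free_shift_pow B Q a hu, ← Algebra.smul_def, Matrix.smul_mulVec,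
      output_smul_initial, outputForm_smul_left]

theorem IsSchur.exists_outputForm_free_bound (Q : Matrix (Fin n ⊕ ι) (Fin n ⊕ ι) ℝ)
    (a : Fin n → ℝ) : ∃ C : ℝ, 0 ≤ C ∧ ∀ u : ℕ → ι → ℝ, (Summable fun t => ‖u t‖ ^ 2) →
      outputForm Q (output A B a 0) (output A B 0 u) ^ 2 ≤ C * ∑' t, ‖u t‖ ^ 2 := by
  obtain ⟨C, hC, h⟩ := hA.exists_output_sq_bound B
  obtain ⟨β, hβ, hb⟩ := exists_outputForm_bound Q
  set S := ∑' t, ‖output A B a 0 t‖ ^ 2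
  have hS : 0 ≤ S := tsum_nonneg fun _ => sq_nonneg _
  refine ⟨4 * (β * S) * (β * C), by positivity, fun u hu => ?_⟩
  obtain ⟨h1, h2⟩ := h 0 u hu
  rw [norm_zero, zero_pow two_ne_zero, zero_add] at h2
  set U := ∑' t, ‖u t‖ ^ 2
  set ℓ := outputForm Q (output A B a 0) (output A B 0 u)
  -- Rescaling the free response by `s` turns the additive bound into a quadratic in `s`; its
  -- discriminant gives the constant.
  have key : ∀ s : ℝ, 0 ≤ β * S * (s * s) + ℓ * s + β * C * U := by
    intro s
    have h3 := hb (s • output A B a 0) (output A B 0 u)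
      (by simpa only [Pi.smul_apply, norm_smul, mul_pow] using
        (hA.summable_norm_sq_output_free B a).mul_left _) h1
    have h4 : ∑' t, ‖(s • output A B a 0) t‖ ^ 2 = s ^ 2 * S := by
      simp only [Pi.smul_apply, norm_smul, mul_pow, tsum_mul_left, Real.norm_eq_abs, sq_abs, S]
    rw [outputForm_smul_left, h4] at h3
    have h5 := (abs_le.1 h3).1
    nlinarith [mul_le_mul_of_nonneg_left h2 hβ]
  have h6 := discrim_le_zero key
  rw [discrim] at h6
  linarith

end FreeResponse

/-! ### Domination of the free-response term by the zero-state cost. -/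

section Domination

variable {n : ℕ} {ι : Type*} [Fintype ι]

theorem norm_sq_le_dotProduct_self (x : ι → ℝ) : ‖x‖ ^ 2 ≤ x ⬝ᵥ x := by
  have h0 : 0 ≤ x ⬝ᵥ x := Finset.sum_nonneg fun i _ => mul_self_nonneg _
  have h1 : ‖x‖ ≤ Real.sqrt (x ⬝ᵥ x) := by
    refine (pi_norm_le_iff_of_nonneg (Real.sqrt_nonneg _)).2 fun i => ?_
    refine Real.le_sqrt_of_sq_le ?_
    rw [Real.norm_eq_abs, sq_abs, sq]
    exact Finset.single_le_sum (f := fun i => x i * x i) (fun _ _ => mul_self_nonneg _)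
      (Finset.mem_univ i)
  calc ‖x‖ ^ 2 ≤ Real.sqrt (x ⬝ᵥ x) ^ 2 := pow_le_pow_left₀ (norm_nonneg _) h1 2
    _ = _ := Real.sq_sqrt h0

variable [DecidableEq ι]

/-- An inequality only, because the norm on `ι → ℝ` is the sup norm while Parseval yields the
Euclidean one. -/
theorem tsum_norm_sq_le_integral {u : ℕ → ι → ℝ} (hu : Summable fun t => ‖u t‖) :
    2 * Real.pi * ∑' t, ‖u t‖ ^ 2 ≤
      ∫ θ in (0 : ℝ)..2 * Real.pi, ∑ i, ‖vecGenFun u θ i‖ ^ 2 := by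
  have h1 := integral_vecGenFun_form (1 : Matrix ι ι ℝ) hu
  have h2 : ∀ θ, (star (vecGenFun u θ) ⬝ᵥ
      (1 : Matrix ι ι ℝ).map Complex.ofReal *ᵥ vecGenFun u θ).re =
      ∑ i, ‖vecGenFun u θ i‖ ^ 2 := by
    intro θ
    rw [Matrix.map_one _ Complex.ofReal_zero Complex.ofReal_one, Matrix.one_mulVec, dotProduct,
      Complex.re_sum]
    refine Finset.sum_congr rfl fun l _ => ?_
    rw [Pi.star_apply, Complex.star_def, ← Complex.normSq_eq_conj_mul_self, Complex.ofReal_re,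
      Complex.normSq_eq_norm_sq]
  simp only [h2] at h1
  rw [h1]
  refine mul_le_mul_of_nonneg_left ?_ (by positivity)
  have hs := summable_norm_sq hu
  refine hs.tsum_le_tsum (fun t => ?_) (summable_dotProduct_mulVec 1 hs hs)
  rw [Matrix.one_mulVec]
  exact norm_sq_le_dotProduct_self _

variable {A : Matrix (Fin n) (Fin n) ℝ} (hA : IsSchur A) (B : Matrix (Fin n) ι ℝ)
  (Q : Matrix (Fin n ⊕ ι) (Fin n ⊕ ι) ℝ)
include hA

/-- The linear term of the cost, coming from the initial state, is dominated by the quadratic form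
of the zero-state cost. -/
theorem IsSchur.exists_free_sq_le
    (hfreq : ∀ z : ℂ, ‖z‖ = 1 → (inputPopov A B Q z).PosSemidef)
    {z₀ : ℂ} (hz₀ : ‖z₀‖ = 1) (hpos : (inputPopov A B Q z₀).PosDef)
    (Q' : Matrix (Fin n ⊕ ι) (Fin n ⊕ ι) ℝ) (a : Fin n → ℝ) :
    ∃ C : ℝ, 0 ≤ C ∧ ∀ u : ℕ → ι → ℝ, (Summable fun t => ‖u t‖) →
      outputForm Q' (output A B a 0) (output A B 0 u) ^ 2 ≤
        C * outputForm Q (output A B 0 u) (output A B 0 u) := by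
  obtain ⟨p, K, hp, hK, hle⟩ := hA.exists_polynomial_lower_bound B Q hfreq hz₀ hpos
  obtain ⟨a', ha'⟩ : ∃ a', Polynomial.aeval A p *ᵥ a' = a := by
    obtain ⟨P, hP⟩ := hp.exists_right_inv
    exact ⟨P *ᵥ a, by rw [Matrix.mulVec_mulVec, hP, Matrix.one_mulVec]⟩
  obtain ⟨C, hC, hb⟩ := hA.exists_outputForm_free_bound B Q' a'
  refine ⟨C * (Fintype.card ι * K), by positivity, fun u hu => ?_⟩
  obtain ⟨hpu, hgen⟩ := summable_norm_aeval_shift hu p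
  rw [← ha', ← hA.outputForm_free_aeval B Q' a' hu p]
  refine (hb _ (summable_norm_sq hpu)).trans ?_
  rw [mul_assoc]
  refine mul_le_mul_of_nonneg_left ?_ hC
  have hcu := continuous_vecGenFun hpu
  have hmono : ∫ θ in (0 : ℝ)..2 * Real.pi,
      ∑ i, ‖vecGenFun (Polynomial.aeval (shift ι) p u) θ i‖ ^ 2 ≤
      ∫ θ in (0 : ℝ)..2 * Real.pi, Fintype.card ι * K *
        (star (vecGenFun u θ) ⬝ᵥ inputPopov A B Q (unitExp θ)⁻¹ *ᵥ vecGenFun u θ).re := by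
    refine intervalIntegral.integral_mono (by positivity)
      (Continuous.intervalIntegrable (by fun_prop) _ _)
      (((hA.continuous_inputPopov_form B Q hu).const_mul _).intervalIntegrable _ _) fun θ => ?_
    change ∑ i, ‖vecGenFun (Polynomial.aeval (shift ι) p u) θ i‖ ^ 2 ≤ _
    calc _ ≤ ∑ _i : ι, K *
        (star (vecGenFun u θ) ⬝ᵥ inputPopov A B Q (unitExp θ)⁻¹ *ᵥ vecGenFun u θ).re := by
          refine Finset.sum_le_sum fun i _ => ?_
          -- The shift produces p at ζ while the Popov bound is at ζ⁻¹; the moduli agree because p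
          -- has real coefficients.
          rw [hgen, Pi.smul_apply, smul_eq_mul, norm_mul, mul_pow,
            ← norm_aeval_inv_of_norm_eq_one p (norm_unitExp θ)]
          exact hle _ (by simp) _ i
      _ = _ := by
          rw [Finset.sum_const, Finset.card_univ, nsmul_eq_mul, mul_assoc]
  have h2 := (tsum_norm_sq_le_integral hpu).trans hmono
  rw [intervalIntegral.integral_const_mul, hA.integral_inputPopov B Q hu, mul_left_comm] at h2
  exact le_of_mul_le_mul_left h2 (by positivity)

end Domination

/-! ### Restriction of the input to the range of a constant matrix. -/

section Restriction

variable {n : ℕ} {ι κ : Type*} [Fintype ι] [Fintype κ]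

/-- The matrix sending `(x, μ)` to `(x, J μ)`. -/
def augment (n : ℕ) (J : Matrix ι κ ℝ) : Matrix (Fin n ⊕ ι) (Fin n ⊕ κ) ℝ :=
  Matrix.fromBlocks 1 0 0 J

theorem traj_comp (A : Matrix (Fin n) (Fin n) ℝ) (B : Matrix (Fin n) ι ℝ) (J : Matrix ι κ ℝ)
    (a : Fin n → ℝ) (μ : ℕ → κ → ℝ) (t : ℕ) :
    traj A B a (fun t => J *ᵥ μ t) t = traj A (B * J) a μ t := by
  induction t with
  | zero => rfl
  | succ t ih => rw [traj, traj, ih, Matrix.mulVec_mulVec]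

theorem output_comp (A : Matrix (Fin n) (Fin n) ℝ) (B : Matrix (Fin n) ι ℝ) (J : Matrix ι κ ℝ)
    (a : Fin n → ℝ) (μ : ℕ → κ → ℝ) :
    output A B a (fun t => J *ᵥ μ t) = fun t => augment n J *ᵥ output A (B * J) a μ t := by
  ext t
  rw [output, traj_comp, augment, output, Matrix.fromBlocks_mulVec]
  simp

theorem outputForm_mulVec {m l : Type*} [Fintype m] [Fintype l] (Q : Matrix m m ℝ)
    (M : Matrix m l ℝ) (y y' : ℕ → l → ℝ) :
    outputForm Q (fun t => M *ᵥ y t) (fun t => M *ᵥ y' t) = outputForm (Mᵀ * Q * M) y y' := by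
  unfold outputForm
  refine tsum_congr fun t => ?_
  rw [← Matrix.mulVec_mulVec, ← Matrix.mulVec_mulVec, Matrix.mulVec_transpose,
    dotProduct_comm (y t), ← Matrix.dotProduct_mulVec, dotProduct_comm]

variable [DecidableEq ι] [DecidableEq κ]

/-- Restricting inputs to the range of `J` is a system with input matrix `B * J`, so one-player
bounds apply to each diagonal block of the two-player Popov function. -/
theorem inputPopov_comp (A : Matrix (Fin n) (Fin n) ℝ) (B : Matrix (Fin n) ι ℝ)
    (J : Matrix ι κ ℝ) (Q : Matrix (Fin n ⊕ ι) (Fin n ⊕ ι) ℝ) (z : ℂ) :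
    inputPopov A (B * J) ((augment n J)ᵀ * Q * augment n J) z =
      (J.map Complex.ofReal)ᴴ * inputPopov A B Q z * J.map Complex.ofReal := by
  have h1 : (augment n J).map Complex.ofReal * inputTransfer A (B * J) z =
      inputTransfer A B z * J.map Complex.ofReal := by
    rw [augment, Matrix.fromBlocks_map, inputTransfer, inputTransfer, Matrix.fromBlocks_mul_fromRows,
      Matrix.fromRows_mul]
    have hBJ : (B * J).map Complex.ofReal = B.map Complex.ofReal * J.map Complex.ofReal :=
      Matrix.map_mul (f := Complex.ofRealHom)
    rw [hBJ]
    simp [Matrix.mul_assoc, Matrix.map_one]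
  have h2 : ((augment n J)ᵀ * Q * augment n J).map Complex.ofReal =
      ((augment n J).map Complex.ofReal)ᴴ * Q.map Complex.ofReal *
        (augment n J).map Complex.ofReal := by
    have h3 : ((augment n J).map Complex.ofReal)ᴴ = ((augment n J)ᵀ).map Complex.ofReal := by
      ext i j
      simp
    rw [h3]
    exact (Matrix.map_mul (f := Complex.ofRealHom)).trans
      (congrArg (· * _) (Matrix.map_mul (f := Complex.ofRealHom)))
  have h4 := congrArg Matrix.conjTranspose h1
  rw [Matrix.conjTranspose_mul, Matrix.conjTranspose_mul] at h4
  rw [inputPopov, h2, inputPopov]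
  calc _ = ((inputTransfer A (B * J) z)ᴴ * ((augment n J).map Complex.ofReal)ᴴ) *
        Q.map Complex.ofReal * ((augment n J).map Complex.ofReal * inputTransfer A (B * J) z) := by
        simp only [Matrix.mul_assoc]
    _ = _ := by
        rw [h4, h1]
        simp only [Matrix.mul_assoc]

variable {A : Matrix (Fin n) (Fin n) ℝ} (hA : IsSchur A) (B : Matrix (Fin n) ι ℝ)
  (J : Matrix ι κ ℝ) (Q : Matrix (Fin n ⊕ ι) (Fin n ⊕ ι) ℝ)
include hA

theorem IsSchur.exists_free_sq_le_comp
    (hfreq : ∀ z : ℂ, ‖z‖ = 1 →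
      ((J.map Complex.ofReal)ᴴ * inputPopov A B Q z * J.map Complex.ofReal).PosSemidef)
    {z₀ : ℂ} (hz₀ : ‖z₀‖ = 1)
    (hpos : ((J.map Complex.ofReal)ᴴ * inputPopov A B Q z₀ * J.map Complex.ofReal).PosDef)
    (Q' : Matrix (Fin n ⊕ ι) (Fin n ⊕ ι) ℝ) (a : Fin n → ℝ) :
    ∃ C : ℝ, 0 ≤ C ∧ ∀ μ : ℕ → κ → ℝ, (Summable fun t => ‖μ t‖) →
      outputForm Q' (output A B a 0) (output A B 0 fun t => J *ᵥ μ t) ^ 2 ≤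
        C * outputForm Q (output A B 0 fun t => J *ᵥ μ t) (output A B 0 fun t => J *ᵥ μ t) := by
  have h0 : output A B a 0 = fun t => augment n J *ᵥ output A (B * J) a 0 t := by
    rw [← output_comp]
    congr 1
    ext t i
    simp
  simp only [h0, output_comp, outputForm_mulVec]
  refine hA.exists_free_sq_le (B * J) _ (fun z hz => ?_) hz₀ ?_ _ a
  · rw [inputPopov_comp]
    exact hfreq z hz
  · rwa [inputPopov_comp]

end Restriction

/-! ### Square summable inputs and density of the summable ones. -/

section SquareSummable

theorem norm_ofLp_le {m : ℕ} (x : EuclideanSpace ℝ (Fin m)) : ‖x.ofLp‖ ≤ ‖x‖ :=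
  (pi_norm_le_iff_of_nonneg (norm_nonneg _)).2 fun i => PiLp.norm_apply_le x i

theorem hasSum_norm_sq {m : ℕ} (v : Ell2 m) : HasSum (fun t => ‖v t‖ ^ 2) (‖v‖ ^ 2) := by
  have h := lp.hasSum_norm (p := 2) (by norm_num) v
  simpa using h

/-- The joint input sequence. -/
def jointInput {k q : ℕ} (v : Ell2 k) (w : Ell2 q) (t : ℕ) : Fin k ⊕ Fin q → ℝ :=
  Sum.elim (v t).ofLp (w t).ofLp

theorem norm_jointInput_sq_le {k q : ℕ} (v : Ell2 k) (w : Ell2 q) (t : ℕ) :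
    ‖jointInput v w t‖ ^ 2 ≤ 2 * ‖v t‖ ^ 2 + 2 * ‖w t‖ ^ 2 := by
  refine (norm_sumElim_sq_le _ _).trans ?_
  have h1 := pow_le_pow_left₀ (norm_nonneg _) (norm_ofLp_le (v t)) 2
  have h2 := pow_le_pow_left₀ (norm_nonneg _) (norm_ofLp_le (w t)) 2
  linarith

theorem summable_norm_jointInput_sq {k q : ℕ} (v : Ell2 k) (w : Ell2 q) :
    Summable fun t => ‖jointInput v w t‖ ^ 2 :=
  Summable.of_nonneg_of_le (fun _ => sq_nonneg _) (norm_jointInput_sq_le v w)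
    (((hasSum_norm_sq v).summable.mul_left 2).add ((hasSum_norm_sq w).summable.mul_left 2))

theorem tsum_norm_jointInput_sq_le {k q : ℕ} (v : Ell2 k) (w : Ell2 q) :
    ∑' t, ‖jointInput v w t‖ ^ 2 ≤ 2 * ‖v‖ ^ 2 + 2 * ‖w‖ ^ 2 :=
  hasSum_le (norm_jointInput_sq_le v w) (summable_norm_jointInput_sq v w).hasSum
    (((hasSum_norm_sq v).mul_left 2).add ((hasSum_norm_sq w).mul_left 2))

theorem summable_norm_jointInput {k q : ℕ} {v : Ell2 k} {w : Ell2 q}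
    (hv : Summable fun t => ‖v t‖) (hw : Summable fun t => ‖w t‖) :
    Summable fun t => ‖jointInput v w t‖ :=
  Summable.of_nonneg_of_le (fun _ => norm_nonneg _)
    (fun _ => (norm_sumElim_le _ _).trans (add_le_add (norm_ofLp_le _) (norm_ofLp_le _)))
    (hv.add hw)

/-- Absolutely summable sequences are dense in the square summable ones. -/
theorem dense_summable_norm (m : ℕ) : Dense {v : Ell2 m | Summable fun t => ‖v t‖} := by
  intro v
  have h := lp.hasSum_single (p := 2) ENNReal.ofNat_ne_top v
  refine mem_closure_of_tendsto h (.of_forall fun s => ?_)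
  refine summable_of_ne_finset_zero (s := s) fun _ ht => ?_
  rw [lp.coeFn_sum, Finset.sum_apply, norm_eq_zero]
  refine Finset.sum_eq_zero fun i hi => ?_
  exact lp.single_apply_ne 2 i _ fun h => ht (h ▸ hi)

theorem forall_ell2_of_summable {m : ℕ} {P : Ell2 m → Prop} (hP : IsClosed {v | P v})
    (h : ∀ v : Ell2 m, (Summable fun t => ‖v t‖) → P v) (v : Ell2 m) : P v :=
  hP.closure_subset_iff.2 h (dense_summable_norm m v)

end SquareSummable

/-! ### The cost as a bounded bilinear form on initial states and inputs. -/

section CostForm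

/-- Normalising both arguments turns the sum of squares into the constant 2. -/
theorem exists_clm_of_bilinear_bound {E : Type*} [NormedAddCommGroup E] [NormedSpace ℝ E]
    (b : E →ₗ[ℝ] E →ₗ[ℝ] ℝ) (K : ℝ) (h : ∀ x y, |b x y| ≤ K * (‖x‖ ^ 2 + ‖y‖ ^ 2)) :
    ∃ f : E →L[ℝ] E →L[ℝ] ℝ, ∀ x y, f x y = b x y := by
  refine ⟨LinearMap.mkContinuous₂ b (2 * K) fun x y => ?_, fun x y => rfl⟩
  rcases eq_or_ne x 0 with rfl | hx
  · simp
  rcases eq_or_ne y 0 with rfl | hy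
  · simp
  have hx' := norm_pos_iff.2 hx
  have hy' := norm_pos_iff.2 hy
  have h1 := h (‖x‖⁻¹ • x) (‖y‖⁻¹ • y)
  rw [map_smul, map_smul, LinearMap.smul_apply, smul_eq_mul, smul_eq_mul, abs_mul, abs_mul,
    norm_smul, norm_smul, norm_inv, norm_inv, norm_norm, norm_norm, inv_mul_cancel₀ hx'.ne',
    inv_mul_cancel₀ hy'.ne', abs_of_pos (inv_pos.2 hx'), abs_of_pos (inv_pos.2 hy'),
    inv_mul_le_iff₀ hy', inv_mul_le_iff₀ hx'] at h1
  rw [Real.norm_eq_abs]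
  linarith

variable {n k q : ℕ} (A : Matrix (Fin n) (Fin n) ℝ) (B₁ : Matrix (Fin n) (Fin k) ℝ)
  (B₂ : Matrix (Fin n) (Fin q) ℝ)

theorem state_eq_traj (a : Fin n → ℝ) (v : Ell2 k) (w : Ell2 q) (t : ℕ) :
    state A B₁ B₂ a v w t = traj A (Matrix.fromCols B₁ B₂) a (jointInput v w) t := by
  induction t with
  | zero => rfl
  | succ t ih =>
    rw [state, traj, ih, jointInput, Matrix.fromCols_mulVec_sumElim, add_assoc]

/-- The stacked sequence of states and inputs of the two-player system. -/
def jointOutput (e : (Fin n → ℝ) × Ell2 k × Ell2 q) : ℕ → Fin n ⊕ (Fin k ⊕ Fin q) → ℝ :=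
  output A (Matrix.fromCols B₁ B₂) e.1 (jointInput e.2.1 e.2.2)

theorem stageCost_eq (Q : Matrix (Fin n ⊕ (Fin k ⊕ Fin q)) (Fin n ⊕ (Fin k ⊕ Fin q)) ℝ)
    (a : Fin n → ℝ) (v : Ell2 k) (w : Ell2 q) (t : ℕ) :
    stageCost A B₁ B₂ Q a v w t =
      jointOutput A B₁ B₂ (a, v, w) t ⬝ᵥ Q *ᵥ jointOutput A B₁ B₂ (a, v, w) t := by
  rw [stageCost, state_eq_traj]
  rfl

theorem cost_eq_outputForm
    (Q : Matrix (Fin n ⊕ (Fin k ⊕ Fin q)) (Fin n ⊕ (Fin k ⊕ Fin q)) ℝ)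
    (a : Fin n → ℝ) (v : Ell2 k) (w : Ell2 q) :
    cost A B₁ B₂ Q a v w =
      outputForm Q (jointOutput A B₁ B₂ (a, v, w)) (jointOutput A B₁ B₂ (a, v, w)) :=
  tsum_congr fun t => stageCost_eq A B₁ B₂ Q a v w t

theorem jointOutput_add (e e' : (Fin n → ℝ) × Ell2 k × Ell2 q) :
    jointOutput A B₁ B₂ (e + e') = jointOutput A B₁ B₂ e + jointOutput A B₁ B₂ e' := by
  rw [jointOutput, jointOutput, jointOutput, ← output_add]
  congr 1
  ext t (i | i) <;> rfl

theorem jointOutput_smul (c : ℝ) (e : (Fin n → ℝ) × Ell2 k × Ell2 q) :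
    jointOutput A B₁ B₂ (c • e) = c • jointOutput A B₁ B₂ e := by
  rw [jointOutput, jointOutput, ← output_smul]
  congr 1
  ext t (i | i) <;> rfl

variable {A}

theorem IsSchur.exists_jointOutput_bound (hA : IsSchur A) :
    ∃ C : ℝ, 0 ≤ C ∧ ∀ e : (Fin n → ℝ) × Ell2 k × Ell2 q,
      (Summable fun t => ‖jointOutput A B₁ B₂ e t‖ ^ 2) ∧
      ∑' t, ‖jointOutput A B₁ B₂ e t‖ ^ 2 ≤ C * ‖e‖ ^ 2 := by
  obtain ⟨C, hC, h⟩ := hA.exists_output_sq_bound (Matrix.fromCols B₁ B₂)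
  -- 5 = 1 + 2 + 2: one from the initial state and two from each input, all bounded by the sup norm
  -- of the product.
  refine ⟨C * 5, by positivity, fun e => ?_⟩
  obtain ⟨h1, h2⟩ := h e.1 (jointInput e.2.1 e.2.2) (summable_norm_jointInput_sq _ _)
  refine ⟨h1, h2.trans ?_⟩
  rw [mul_assoc]
  refine mul_le_mul_of_nonneg_left ?_ hC
  have h3 := tsum_norm_jointInput_sq_le e.2.1 e.2.2
  have h4 := pow_le_pow_left₀ (norm_nonneg _) (norm_fst_le e) 2
  have h5 := pow_le_pow_left₀ (norm_nonneg _) ((norm_fst_le e.2).trans (norm_snd_le e)) 2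
  have h6 := pow_le_pow_left₀ (norm_nonneg _) ((norm_snd_le e.2).trans (norm_snd_le e)) 2
  linarith

/-- The cost pairing is a bounded bilinear form on initial states and inputs. -/
theorem IsSchur.exists_cost_clm (hA : IsSchur A)
    (Q : Matrix (Fin n ⊕ (Fin k ⊕ Fin q)) (Fin n ⊕ (Fin k ⊕ Fin q)) ℝ) :
    ∃ f : (Fin n → ℝ) × Ell2 k × Ell2 q →L[ℝ] (Fin n → ℝ) × Ell2 k × Ell2 q →L[ℝ] ℝ,
      ∀ e e', f e e' = outputForm Q (jointOutput A B₁ B₂ e) (jointOutput A B₁ B₂ e') := by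
  obtain ⟨C, hC, h⟩ := hA.exists_jointOutput_bound B₁ B₂
  obtain ⟨β, hβ, hb⟩ := exists_outputForm_bound Q
  let b := LinearMap.mk₂ ℝ
    (fun e e' : (Fin n → ℝ) × Ell2 k × Ell2 q =>
      outputForm Q (jointOutput A B₁ B₂ e) (jointOutput A B₁ B₂ e'))
    (fun e₁ e₂ e' => by
      rw [jointOutput_add, outputForm_add_left Q (h e₁).1 (h e₂).1 (h e').1])
    (fun c e e' => by rw [jointOutput_smul, outputForm_smul_left, smul_eq_mul])
    (fun e e₁ e₂ => by
      rw [jointOutput_add, outputForm_add_right Q (h e).1 (h e₁).1 (h e₂).1])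
    (fun c e e' => by rw [jointOutput_smul, outputForm_smul_right, smul_eq_mul])
  refine exists_clm_of_bilinear_bound b (β * C) fun e e' => ?_
  refine (hb _ _ (h e).1 (h e').1).trans ?_
  rw [mul_assoc]
  refine mul_le_mul_of_nonneg_left ?_ hβ
  linarith [(h e).2, (h e').2]

end CostForm

/-! ### From the frequency condition to an inequality between zero-state costs. -/

section FrequencyInequality

/-- The embedding of the first player's inputs. -/
def inputInl (k q : ℕ) : Matrix (Fin k ⊕ Fin q) (Fin k) ℝ := Matrix.fromRows 1 0

/-- The embedding of the second player's inputs. -/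
def inputInr (k q : ℕ) : Matrix (Fin k ⊕ Fin q) (Fin q) ℝ := Matrix.fromRows 0 1

theorem conj_inputInl {k q : ℕ} (M : Matrix (Fin k ⊕ Fin q) (Fin k ⊕ Fin q) ℂ) :
    ((inputInl k q).map Complex.ofReal)ᴴ * M * (inputInl k q).map Complex.ofReal =
      M.toBlocks₁₁ := by
  ext i j
  simp [inputInl, Matrix.mul_apply, Matrix.one_apply, Fintype.sum_sum_type, Matrix.toBlocks₁₁,
    apply_ite]

theorem conj_inputInr {k q : ℕ} (M : Matrix (Fin k ⊕ Fin q) (Fin k ⊕ Fin q) ℂ) :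
    ((inputInr k q).map Complex.ofReal)ᴴ * M * (inputInr k q).map Complex.ofReal =
      M.toBlocks₂₂ := by
  ext i j
  simp [inputInr, Matrix.mul_apply, Matrix.one_apply, Fintype.sum_sum_type, Matrix.toBlocks₂₂,
    apply_ite]

theorem jointInput_zero_right {k q : ℕ} (v : Ell2 k) :
    jointInput v (0 : Ell2 q) = fun t => inputInl k q *ᵥ (v t).ofLp := by
  ext t (i | i) <;> simp [jointInput, inputInl, Matrix.fromRows_mulVec]

theorem jointInput_zero_left {k q : ℕ} (w : Ell2 q) :
    jointInput (0 : Ell2 k) w = fun t => inputInr k q *ᵥ (w t).ofLp := by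
  ext t (i | i) <;> simp [jointInput, inputInr, Matrix.fromRows_mulVec]

theorem vecGenFun_jointInput_zero_right {k q : ℕ} (v : Ell2 k) (w : Ell2 q) (θ : ℝ) :
    vecGenFun (jointInput v (0 : Ell2 q)) θ =
      Sum.elim (fun i => vecGenFun (jointInput v w) θ (Sum.inl i)) 0 := by
  ext (i | i) <;> simp [vecGenFun, jointInput, genFun]

theorem vecGenFun_jointInput_zero_left {k q : ℕ} (v : Ell2 k) (w : Ell2 q) (θ : ℝ) :
    vecGenFun (jointInput (0 : Ell2 k) w) θ =
      Sum.elim (0 : Fin k → ℂ) (fun i => vecGenFun (jointInput v w) θ (Sum.inr i)) := by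
  ext (i | i) <;> simp [vecGenFun, jointInput, genFun]

/-- The coupling is isolated by subtracting both diagonal forms from the full form. The scaled form
thus combines three unscaled ones, each the integrand of a cost. -/
theorem scaled_form_eq {k q : ℕ} (M : Matrix (Fin k ⊕ Fin q) (Fin k ⊕ Fin q) ℂ) (ε : ℝ)
    (ξ : Fin k → ℂ) (η : Fin q → ℂ) :
    (star (Sum.elim ξ η) ⬝ᵥ Matrix.fromBlocks M.toBlocks₁₁ ((ε : ℂ) • M.toBlocks₁₂)
      ((ε : ℂ) • M.toBlocks₂₁) (-M.toBlocks₂₂) *ᵥ Sum.elim ξ η).re =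
      (1 - ε) * (star (Sum.elim ξ (0 : Fin q → ℂ)) ⬝ᵥ M *ᵥ Sum.elim ξ (0 : Fin q → ℂ)).re -
        (1 + ε) * (star (Sum.elim (0 : Fin k → ℂ) η) ⬝ᵥ M *ᵥ Sum.elim (0 : Fin k → ℂ) η).re +
        ε * (star (Sum.elim ξ η) ⬝ᵥ M *ᵥ Sum.elim ξ η).re := by
  have hstar : ∀ (x : Fin k → ℂ) (y : Fin q → ℂ),
      star (Sum.elim x y) = Sum.elim (star x) (star y) := fun x y => by
    ext (i | i) <;> rfl
  rw [← Complex.re_ofReal_mul, ← Complex.re_ofReal_mul, ← Complex.re_ofReal_mul, ← Complex.sub_re,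
    ← Complex.add_re]
  congr 1
  obtain ⟨M₁, M₂, M₃, M₄, rfl⟩ : ∃ M₁ M₂ M₃ M₄, M = Matrix.fromBlocks M₁ M₂ M₃ M₄ :=
    ⟨_, _, _, _, (Matrix.fromBlocks_toBlocks M).symm⟩
  simp only [Matrix.toBlocks_fromBlocks₁₁, Matrix.toBlocks_fromBlocks₁₂,
    Matrix.toBlocks_fromBlocks₂₁, Matrix.toBlocks_fromBlocks₂₂, hstar, Matrix.fromBlocks_mulVec,
    sumElim_dotProduct_sumElim, Sum.elim_comp_inl, Sum.elim_comp_inr, Matrix.smul_mulVec,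
    Matrix.neg_mulVec, dotProduct_add, dotProduct_smul, dotProduct_neg, Matrix.mulVec_zero,
    star_zero, zero_dotProduct, smul_eq_mul]
  push_cast
  simp only [add_zero, zero_add, dotProduct_zero]
  ring

theorem IsSchur.scaled_cost_nonneg {n k q : ℕ} {A : Matrix (Fin n) (Fin n) ℝ} (hA : IsSchur A)
    (B₁ : Matrix (Fin n) (Fin k) ℝ) (B₂ : Matrix (Fin n) (Fin q) ℝ)
    (Q : Matrix (Fin n ⊕ (Fin k ⊕ Fin q)) (Fin n ⊕ (Fin k ⊕ Fin q)) ℝ) (ε : ℝ)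
    (hfreq : ∀ z : ℂ, ‖z‖ = 1 → (scaledPopov A B₁ B₂ Q ε z).PosSemidef)
    {v : Ell2 k} {w : Ell2 q} (hv : Summable fun t => ‖v t‖) (hw : Summable fun t => ‖w t‖) :
    0 ≤ (1 - ε) * cost A B₁ B₂ Q 0 v 0 - (1 + ε) * cost A B₁ B₂ Q 0 0 w +
      ε * cost A B₁ B₂ Q 0 v w := by
  have h0 : ∀ m : ℕ, Summable fun t => ‖(0 : Ell2 m) t‖ := fun m => by simp
  have key : ∀ {v : Ell2 k} {w : Ell2 q}, (Summable fun t => ‖v t‖) →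
      (Summable fun t => ‖w t‖) → _ := fun {v w} hv hw =>
    hA.integral_inputPopov (Matrix.fromCols B₁ B₂) Q (summable_norm_jointInput hv hw)
  have hint : ∀ {v : Ell2 k} {w : Ell2 q}, (Summable fun t => ‖v t‖) →
      (Summable fun t => ‖w t‖) → ∀ c : ℝ, _ := fun {v w} hv hw c =>
    ((hA.continuous_inputPopov_form (Matrix.fromCols B₁ B₂) Q
      (summable_norm_jointInput hv hw)).const_mul c).intervalIntegrable (μ := MeasureTheory.volume)
      0 (2 * Real.pi)
  have hkey : 2 * Real.pi * ((1 - ε) * cost A B₁ B₂ Q 0 v 0 - (1 + ε) * cost A B₁ B₂ Q 0 0 w +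
      ε * cost A B₁ B₂ Q 0 v w) = ∫ θ in (0 : ℝ)..2 * Real.pi,
        (star (vecGenFun (jointInput v w) θ) ⬝ᵥ scaledPopov A B₁ B₂ Q ε (unitExp θ)⁻¹ *ᵥ
          vecGenFun (jointInput v w) θ).re := by
    have hpt : ∀ θ, (star (vecGenFun (jointInput v w) θ) ⬝ᵥ
        scaledPopov A B₁ B₂ Q ε (unitExp θ)⁻¹ *ᵥ vecGenFun (jointInput v w) θ).re =
        (1 - ε) * (star (vecGenFun (jointInput v 0) θ) ⬝ᵥ
          inputPopov A (Matrix.fromCols B₁ B₂) Q (unitExp θ)⁻¹ *ᵥ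
            vecGenFun (jointInput v 0) θ).re -
        (1 + ε) * (star (vecGenFun (jointInput 0 w) θ) ⬝ᵥ
          inputPopov A (Matrix.fromCols B₁ B₂) Q (unitExp θ)⁻¹ *ᵥ
            vecGenFun (jointInput 0 w) θ).re +
        ε * (star (vecGenFun (jointInput v w) θ) ⬝ᵥ
          inputPopov A (Matrix.fromCols B₁ B₂) Q (unitExp θ)⁻¹ *ᵥ
            vecGenFun (jointInput v w) θ).re := by
      intro θ
      rw [vecGenFun_jointInput_zero_right v w, vecGenFun_jointInput_zero_left v w]
      have hu : vecGenFun (jointInput v w) θ =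
          Sum.elim (fun i => vecGenFun (jointInput v w) θ (Sum.inl i))
            (fun i => vecGenFun (jointInput v w) θ (Sum.inr i)) := by
        ext (i | i) <;> rfl
      generalize vecGenFun (jointInput v w) θ = u at hu ⊢
      conv_lhs => rw [hu]
      conv_rhs => enter [2]; rw [hu]
      exact scaled_form_eq _ ε _ _
    simp only [hpt]
    rw [intervalIntegral.integral_add ((hint hv (h0 q) _).sub (hint (h0 k) hw _)) (hint hv hw _),
      intervalIntegral.integral_sub (hint hv (h0 q) _) (hint (h0 k) hw _),
      intervalIntegral.integral_const_mul, intervalIntegral.integral_const_mul,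
      intervalIntegral.integral_const_mul, key hv (h0 q), key (h0 k) hw, key hv hw]
    simp only [cost_eq_outputForm, jointOutput]
    ring
  have h2 : 0 ≤ 2 * Real.pi * ((1 - ε) * cost A B₁ B₂ Q 0 v 0 -
      (1 + ε) * cost A B₁ B₂ Q 0 0 w + ε * cost A B₁ B₂ Q 0 v w) := by
    rw [hkey]
    exact intervalIntegral.integral_nonneg (by positivity) fun θ _ =>
      (hfreq _ (by simp)).re_dotProduct_nonneg _
  exact nonneg_of_mul_nonneg_right h2 (by positivity)

end FrequencyInequality

/-! ### Domination of the free-response term for each player separately. -/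

section FreeTerm

variable {n k q : ℕ} {A : Matrix (Fin n) (Fin n) ℝ} (hA : IsSchur A)
  (B₁ : Matrix (Fin n) (Fin k) ℝ) (B₂ : Matrix (Fin n) (Fin q) ℝ)
  (Q Q' : Matrix (Fin n ⊕ (Fin k ⊕ Fin q)) (Fin n ⊕ (Fin k ⊕ Fin q)) ℝ)

theorem summable_norm_ofLp {m : ℕ} {v : Ell2 m} (hv : Summable fun t => ‖v t‖) :
    Summable fun t => ‖(v t).ofLp‖ :=
  Summable.of_nonneg_of_le (fun _ => norm_nonneg _) (fun _ => norm_ofLp_le _) hv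

theorem jointInput_zero_zero : jointInput (0 : Ell2 k) (0 : Ell2 q) = 0 := by
  ext t (i | i) <;> rfl

theorem neg_outputForm {κ : Type*} [Fintype κ] (Q : Matrix κ κ ℝ) (y y' : ℕ → κ → ℝ) :
    outputForm (-Q) y y' = -outputForm Q y y' := by
  unfold outputForm
  rw [← tsum_neg]
  simp only [Matrix.neg_mulVec, dotProduct_neg]

theorem neg_inputPopov {ι : Type*} [Fintype ι] [DecidableEq ι] (A : Matrix (Fin n) (Fin n) ℝ)
    (B : Matrix (Fin n) ι ℝ) (Q : Matrix (Fin n ⊕ ι) (Fin n ⊕ ι) ℝ) (z : ℂ) :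
    inputPopov A B (-Q) z = -inputPopov A B Q z := by
  have h : (-Q).map Complex.ofReal = -Q.map Complex.ofReal := by
    ext i j
    simp
  rw [inputPopov, h, Matrix.mul_neg, Matrix.neg_mul, inputPopov]

include hA

theorem IsSchur.exists_free_sq_le_inl
    (hfreq : ∀ z : ℂ, ‖z‖ = 1 → (popov A B₁ B₂ Q z).toBlocks₁₁.PosSemidef)
    {z₀ : ℂ} (hz₀ : ‖z₀‖ = 1) (hpos : (popov A B₁ B₂ Q z₀).toBlocks₁₁.PosDef) (a : Fin n → ℝ) :
    ∃ C : ℝ, 0 ≤ C ∧ ∀ v : Ell2 k, (Summable fun t => ‖v t‖) →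
      outputForm Q' (jointOutput A B₁ B₂ (a, 0, 0)) (jointOutput A B₁ B₂ (0, v, 0)) ^ 2 ≤
        C * outputForm Q (jointOutput A B₁ B₂ (0, v, 0)) (jointOutput A B₁ B₂ (0, v, 0)) := by
  obtain ⟨C, hC, h⟩ := hA.exists_free_sq_le_comp (Matrix.fromCols B₁ B₂) (inputInl k q) Q
    (fun z hz => by rw [conj_inputInl]; exact hfreq z hz) hz₀
    (by rw [conj_inputInl]; exact hpos) Q' a
  refine ⟨C, hC, fun v hv => ?_⟩
  have := h (fun t => (v t).ofLp) (summable_norm_ofLp hv)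
  simp only [jointOutput]
  rwa [jointInput_zero_zero, jointInput_zero_right]

theorem IsSchur.exists_free_sq_le_inr
    (hfreq : ∀ z : ℂ, ‖z‖ = 1 → (-(popov A B₁ B₂ Q z).toBlocks₂₂).PosSemidef)
    {z₀ : ℂ} (hz₀ : ‖z₀‖ = 1) (hpos : (-(popov A B₁ B₂ Q z₀).toBlocks₂₂).PosDef)
    (a : Fin n → ℝ) :
    ∃ C : ℝ, 0 ≤ C ∧ ∀ w : Ell2 q, (Summable fun t => ‖w t‖) →
      outputForm Q' (jointOutput A B₁ B₂ (a, 0, 0)) (jointOutput A B₁ B₂ (0, 0, w)) ^ 2 ≤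
        C * -outputForm Q (jointOutput A B₁ B₂ (0, 0, w)) (jointOutput A B₁ B₂ (0, 0, w)) := by
  have hneg : ∀ z, ((inputInr k q).map Complex.ofReal)ᴴ *
      inputPopov A (Matrix.fromCols B₁ B₂) (-Q) z * (inputInr k q).map Complex.ofReal =
      -(popov A B₁ B₂ Q z).toBlocks₂₂ := by
    intro z
    rw [neg_inputPopov, conj_inputInr]
    rfl
  obtain ⟨C, hC, h⟩ := hA.exists_free_sq_le_comp (Matrix.fromCols B₁ B₂) (inputInr k q) (-Q)
    (fun z hz => by rw [hneg]; exact hfreq z hz) hz₀ (by rw [hneg]; exact hpos) Q' a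
  refine ⟨C, hC, fun w hw => ?_⟩
  have := h (fun t => (w t).ofLp) (summable_norm_ofLp hw)
  simp only [jointOutput]
  rwa [jointInput_zero_zero, jointInput_zero_left, ← neg_outputForm]

end FreeTerm

end KYPMinimax

/-! ### Assembly: the cost as a dominated convex-concave quadratic functional. -/

theorem mainTheorem4 {n k q : ℕ} (A : Matrix (Fin n) (Fin n) ℝ)
    (B₁ : Matrix (Fin n) (Fin k) ℝ) (B₂ : Matrix (Fin n) (Fin q) ℝ)
    (Q : Matrix (Fin n ⊕ (Fin k ⊕ Fin q)) (Fin n ⊕ (Fin k ⊕ Fin q)) ℝ)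
    (hA : KYPMinimax.IsSchur A)
    (ε : ℝ) (hε : 0 < ε)
    (hfreq : ∀ z : ℂ, ‖z‖ = 1 → (KYPMinimax.scaledPopov A B₁ B₂ Q ε z).PosSemidef)
    (z₀ : ℂ) (hz₀ : ‖z₀‖ = 1)
    (h₁ : (KYPMinimax.popov A B₁ B₂ Q z₀).toBlocks₁₁.PosDef)
    (h₂ : (-(KYPMinimax.popov A B₁ B₂ Q z₀).toBlocks₂₂).PosDef)
    (a : Fin n → ℝ) :
    -- the series defining `g = cost A B₁ B₂ Q a` converges, so `g` is a genuine real-valued functional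
    (∀ (v : KYPMinimax.Ell2 k) (w : KYPMinimax.Ell2 q),
      Summable (KYPMinimax.stageCost A B₁ B₂ Q a v w)) ∧
    -- the partial infimum and supremum are finite and continuous
    (∀ w, BddBelow (Set.range fun v => KYPMinimax.cost A B₁ B₂ Q a v w)) ∧
    (∀ v, BddAbove (Set.range fun w => KYPMinimax.cost A B₁ B₂ Q a v w)) ∧
    Continuous (fun w => ⨅ v, KYPMinimax.cost A B₁ B₂ Q a v w) ∧
    Continuous (fun v => ⨆ w, KYPMinimax.cost A B₁ B₂ Q a v w) ∧
    -- the minimax identity, between finite values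
    BddBelow (Set.range fun v => ⨆ w, KYPMinimax.cost A B₁ B₂ Q a v w) ∧
    BddAbove (Set.range fun w => ⨅ v, KYPMinimax.cost A B₁ B₂ Q a v w) ∧
    (⨅ v, ⨆ w, KYPMinimax.cost A B₁ B₂ Q a v w) = ⨆ w, ⨅ v, KYPMinimax.cost A B₁ B₂ Q a v w := by
  open KYPMinimax in
  -- The diagonal blocks of the scaled matrix carry no `ε`.
  have hfreq₁ : ∀ z : ℂ, ‖z‖ = 1 → (popov A B₁ B₂ Q z).toBlocks₁₁.PosSemidef := fun z hz =>
    (hfreq z hz).submatrix Sum.inl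
  have hfreq₂ : ∀ z : ℂ, ‖z‖ = 1 → (-(popov A B₁ B₂ Q z).toBlocks₂₂).PosSemidef := fun z hz =>
    (hfreq z hz).submatrix Sum.inr
  obtain ⟨_, -, hsum⟩ := hA.exists_jointOutput_bound B₁ B₂
  refine ⟨fun v w => ?_, ?_⟩
  · have h := summable_dotProduct_mulVec Q (hsum (a, v, w)).1 (hsum (a, v, w)).1
    exact h.congr fun t => (stageCost_eq A B₁ B₂ Q a v w t).symm
  obtain ⟨f, hf⟩ := hA.exists_cost_clm B₁ B₂ Q
  -- `Q` is not assumed symmetric; symmetrising leaves the cost unchanged.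
  let b := (1 / 2 : ℝ) • (f + f.flip)
  have hb : ∀ e e', b e e' = 1 / 2 * (f e e' + f e' e) := fun e e' => rfl
  have hbs : ∀ e e', b e e' = b e' e := fun e e' => by rw [hb, hb, add_comm]
  have hcost : ∀ (a : Fin n → ℝ) v w, cost A B₁ B₂ Q a v w = b (a, v, w) (a, v, w) := by
    intro a v w
    rw [hb, cost_eq_outputForm, hf]
    ring
  let jv : Ell2 k →L[ℝ] (Fin n → ℝ) × Ell2 k × Ell2 q :=
    (ContinuousLinearMap.inr ℝ (Fin n → ℝ) (Ell2 k × Ell2 q)).comp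
      (ContinuousLinearMap.inl ℝ (Ell2 k) (Ell2 q))
  let jw : Ell2 q →L[ℝ] (Fin n → ℝ) × Ell2 k × Ell2 q :=
    (ContinuousLinearMap.inr ℝ (Fin n → ℝ) (Ell2 k × Ell2 q)).comp
      (ContinuousLinearMap.inr ℝ (Ell2 k) (Ell2 q))
  let e₀ : (Fin n → ℝ) × Ell2 k × Ell2 q := (a, 0, 0)
  have hjv : ∀ v, jv v = (0, v, 0) := fun v => rfl
  have hjw : ∀ w, jw w = (0, 0, w) := fun w => rfl
  have hsplit : ∀ v w, ((0 : Fin n → ℝ), v, w) = jv v + jw w := fun v w => by simp [hjv, hjw]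
  have hsplit₀ : ∀ v w, (a, v, w) = e₀ + jv v + jw w := fun v w => by simp [hjv, hjw, e₀]
  -- the frequency inequality, extended by density
  have hmain : ∀ v w, 0 ≤ b (jv v) (jv v) - b (jw w) (jw w) + 2 * ε * b (jv v) (jw w) := by
    intro v w
    refine forall_ell2_of_summable (P := fun v =>
      0 ≤ b (jv v) (jv v) - b (jw w) (jw w) + 2 * ε * b (jv v) (jw w))
      (isClosed_le (by fun_prop) (by fun_prop)) (fun v hv => ?_) v
    refine forall_ell2_of_summable (P := fun w =>
      0 ≤ b (jv v) (jv v) - b (jw w) (jw w) + 2 * ε * b (jv v) (jw w))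
      (isClosed_le (by fun_prop) (by fun_prop)) (fun w hw => ?_) w
    have h := hA.scaled_cost_nonneg B₁ B₂ Q ε hfreq hv hw
    rw [hcost, hcost, hcost, hsplit v w, ← hjv, ← hjw] at h
    simp only [map_add, _root_.add_apply] at h
    rw [hbs (jw w) (jv v)] at h
    linarith
  have hF : ∀ v, 0 ≤ b (jv v) (jv v) := fun v => by simpa using hmain v 0
  have hG : ∀ w, 0 ≤ -b (jw w) (jw w) := fun w => by simpa using hmain 0 w
  have hm : ∀ v w, b (jv v) (jw w) ^ 2 ≤ ε⁻¹ ^ 2 * (b (jv v) (jv v) * -b (jw w) (jw w)) := by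
    intro v w
    -- Replacing `v` by `s • v` in `hmain` gives a quadratic nonnegative for all real `s`; its
    -- discriminant is the Cauchy–Schwarz bound with constant `ε⁻¹`.
    have h : ∀ s : ℝ, 0 ≤ b (jv v) (jv v) * (s * s) + 2 * ε * b (jv v) (jw w) * s +
        -b (jw w) (jw w) := by
      intro s
      have := hmain (s • v) w
      simp only [map_smul, _root_.smul_apply, smul_eq_mul] at this
      linarith
    have hd := discrim_le_zero h
    rw [discrim] at hd
    rw [inv_pow, le_inv_mul_iff₀ (by positivity)]
    linarith
  -- domination of the linear terms
  obtain ⟨C₁, hC₁, hℓ₁⟩ := hA.exists_free_sq_le_inl B₁ B₂ Q Q hfreq₁ hz₀ h₁ a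
  obtain ⟨C₁', hC₁', hℓ₁'⟩ := hA.exists_free_sq_le_inl B₁ B₂ Q Qᵀ hfreq₁ hz₀ h₁ a
  obtain ⟨C₂, hC₂, hℓ₂⟩ := hA.exists_free_sq_le_inr B₁ B₂ Q Q hfreq₂ hz₀ h₂ a
  obtain ⟨C₂', hC₂', hℓ₂'⟩ := hA.exists_free_sq_le_inr B₁ B₂ Q Qᵀ hfreq₂ hz₀ h₂ a
  have hdiag : ∀ e, b e e = f e e := fun e => by
    rw [hb]
    ring
  -- The symmetrised pairing averages those for `Q` and `Qᵀ`, so its square is at most half the sum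
  -- of their squares.
  have hL₁ : ∀ v, b e₀ (jv v) ^ 2 ≤ (C₁ + C₁') * b (jv v) (jv v) := by
    refine forall_ell2_of_summable (isClosed_le (by fun_prop) (by fun_prop)) fun v hv => ?_
    have h3 := hℓ₁ v hv
    have h4 := hℓ₁' v hv
    rw [outputForm_transpose] at h4
    rw [← hf, ← hf, ← hjv, ← hdiag (jv v)] at h3 h4
    rw [hb e₀]
    nlinarith [sq_nonneg (f e₀ (jv v) - f (jv v) e₀), mul_nonneg hC₁ (hF v),
      mul_nonneg hC₁' (hF v)]
  have hL₂ : ∀ w, b e₀ (jw w) ^ 2 ≤ (C₂ + C₂') * -b (jw w) (jw w) := by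
    refine forall_ell2_of_summable (isClosed_le (by fun_prop) (by fun_prop)) fun w hw => ?_
    have h3 := hℓ₂ w hw
    have h4 := hℓ₂' w hw
    rw [outputForm_transpose] at h4
    rw [← hf, ← hf, ← hjw, ← hdiag (jw w)] at h3 h4
    rw [hb e₀]
    nlinarith [sq_nonneg (f e₀ (jw w) - f (jw w) e₀), mul_nonneg hC₂ (hG w),
      mul_nonneg hC₂' (hG w)]
  have hε' : 0 < ε⁻¹ := inv_pos.2 hε
  -- The summand 1 gives C ≤ C², so the linear-term constants are bounded by C².
  set C := 1 + ε⁻¹ + (C₁ + C₁') + (C₂ + C₂')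
  refine minimax_quadratic (b.bilinearComp jv jv) (fun x y => hbs _ _) hF
    (-(b.bilinearComp jw jw)) (fun x y => congrArg Neg.neg (hbs _ _)) hG
    (b.bilinearComp jv jw) ((b e₀).comp jv) ((b e₀).comp jw) (b e₀ e₀) C (by positivity)
    (fun v w => (hm v w).trans ?_) (fun v => (hL₁ v).trans ?_) (fun w => (hL₂ w).trans ?_)
    (fun v w => cost A B₁ B₂ Q a v w) fun v w => ?_
  · refine mul_le_mul_of_nonneg_right (pow_le_pow_left₀ hε'.le ?_ 2) (mul_nonneg (hF v) (hG w))
    simp only [C]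
    linarith
  · refine mul_le_mul_of_nonneg_right ?_ (hF v)
    simp only [C]
    nlinarith
  · refine mul_le_mul_of_nonneg_right ?_ (hG w)
    simp only [C]
    nlinarith
  · change cost A B₁ B₂ Q a v w = b (jv v) (jv v) + 2 * b (jv v) (jw w) - -b (jw w) (jw w) +
      2 * b e₀ (jv v) + 2 * b e₀ (jw w) + b e₀ e₀
    rw [hcost, hsplit₀]
    simp only [map_add, _root_.add_apply]
    rw [hbs (jv v) e₀, hbs (jw w) e₀, hbs (jw w) (jv v)]
    ring
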